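/- Let $T>0$ and $\lambda>0$, write $v(p)=p(1+|p|^2)^{-1/2}$ for $p\in\mathbb R^3$, and let $L^1_{kin}(\mathbb R^6)$ be the set of $g\in L^1(\mathbb R^6)$ with $g\ge 0$ and $\iint\sqrt{1+|p|^2}\,g(x,p)\,dx\,dp<\infty$. Let $f_0\in L^1_{kin}\cap L^\infty(\mathbb R^6)$ and $E_0,B_0\in[L^2(\mathbb R^3)]^3$, and let $(f,E,B)$ be a weak solution on $[0,T[$ with initial data $(f_0,E_0,B_0)$ of the relativistic Vlasov–Maxwell system $$\partial_t f+v\cdot\nabla_x f+(E+v\times B)\cdot\nabla_p f=0,\quad \partial_tE-\nabla\times B=-4\pi j,\quad \partial_tB+\nabla\times E=0,\quad \nabla\cdot E=4\pi\rho,\quad \nabla\cdot B=0,$$ $\rho=\int f\,dp$, $j=\int vf\,dp$; that is, $f\in L^\infty([0,T[;L^1_{kin}\cap L^\infty(\mathbb R^6))$, $E,B\in[L^\infty([0,T[;L^2(\mathbb R^3))]^3$, and the equations, with the initial values, hold in the sense of distributions, tested against smooth functions with compact support in $[0,T[\times\mathbb R^6$ (respectively $[0,T[\times\mathbb R^3$).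 Suppose that $E,B\in[L^1_{loc}(]0,T[;BV_{loc}(\mathbb R^3))]^3$ and that $\rho_\lambda(t,x)=\int|p|^\lambda f(t,x,p)\,dp$ belongs to $L^\infty_{loc}(]0,T[;L^2(\mathbb R^3))$. Put $$\mathcal E(t)=\iint\sqrt{1+|p|^2}\,f(t,x,p)\,dx\,dp+\frac1{8\pi}\int\big(|E(t,x)|^2+|B(t,x)|^2\big)dx ,$$ and let $\mathcal E(0)$ be the same expression for $(f_0,E_0,B_0)$. 1. There is a constant $c\ge\mathcal E(0)$ such that $\mathcal E(t)=c$ for almost every $t\in[0,T[$. 2. If moreover the bound on $\rho_\lambda$ holds up to the initial time, i.e. $\rho_\lambda\in L^\infty_{loc}([0,T[;L^2(\mathbb R^3))$, or if the solution satisfies the energy bound $\mathcal E(t)\le\mathcal E(0)$ for almost every $t\in[0,T[$, then $\mathcal E(t)=\mathcal E(0)$ for almost every $t\in[0,T[$. -/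

import Mathlib

open MeasureTheory Set
open scoped ENNReal NNReal ContDiff

noncomputable section

namespace RVM

/-- Euclidean three-space, used for positions, momenta and field vectors. -/
abbrev R3 := EuclideanSpace ℝ (Fin 3)

/-- The cross product of `ℝ³`. -/
def cross (a b : R3) : R3 :=
  WithLp.toLp 2 (crossProduct (WithLp.ofLp a) (WithLp.ofLp b))

/-- `∂ᵢ gⱼ (x)`. -/
def partialDeriv (g : R3 → R3) (i j : Fin 3) (x : R3) : ℝ :=
  (fderiv ℝ g x (EuclideanSpace.single i 1)) j

/-- `∇ · g`. -/
def divergence (g : R3 → R3) (x : R3) : ℝ := ∑ i, partialDeriv g i i x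

/-- `∇ × g`. -/
def curl (g : R3 → R3) (x : R3) : R3 :=
  !₂[partialDeriv g 1 2 x - partialDeriv g 2 1 x,
     partialDeriv g 2 0 x - partialDeriv g 0 2 x,
     partialDeriv g 0 1 x - partialDeriv g 1 0 x]

/-- The relativistic energy `√(1 + |p|²)` of a particle of momentum `p`. -/
def kin (p : R3) : ℝ := Real.sqrt (1 + ‖p‖ ^ 2)

/-- The relativistic velocity `v = p / √(1 + |p|²)`. -/
def velocity (p : R3) : R3 := (kin p)⁻¹ • p

/-- The Lorentz force `K = E + v × B` at momentum `p`, for field values `e`, `b`. -/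
def lorentz (e b p : R3) : R3 := e + cross (velocity p) b

/-- The charge density `ρ = ∫ f dp`. -/
def chargeDensity (f : ℝ → R3 × R3 → ℝ) (t : ℝ) (x : R3) : ℝ := ∫ p, f t (x, p)

/-- The current density `j = ∫ v f dp`. -/
def currentDensity (f : ℝ → R3 × R3 → ℝ) (t : ℝ) (x : R3) : R3 :=
  ∫ p, f t (x, p) • velocity p

/-- The moment `ρ_l (t, x) = ∫ |p| ^ l f(t, x, p) dp` with values in `[0, ∞]`, for `f ≥ 0`. -/
def moment (l : ℝ) (f : ℝ → R3 × R3 → ℝ) (t : ℝ) (x : R3) : ℝ≥0∞ :=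
  ∫⁻ p, ENNReal.ofReal (‖p‖ ^ l * f t (x, p))

/-- The total energy of a state: kinetic energy plus electromagnetic energy. -/
def totalEnergy (g : R3 × R3 → ℝ) (e b : R3 → R3) : ℝ :=
  (∫ z, kin z.2 * g z) + 1 / (8 * Real.pi) * ∫ x, (‖e x‖ ^ 2 + ‖b x‖ ^ 2)

/-- The class `L¹_kin ∩ L^∞ (ℝ⁶)`. -/
structure MemL1kinLinfty (g : R3 × R3 → ℝ) : Prop where
  nonneg : ∀ᵐ z, 0 ≤ g z
  integrable : Integrable g
  integrable_kin : Integrable fun z => kin z.2 * g z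
  memLp_top : MemLp g (⊤ : ℝ≥0∞)

/-- `u ∈ L^∞ (I; L^q (X))`. -/
def MemLinftyLp {X F : Type*} [MeasureSpace X] [TopologicalSpace F] [ENorm F]
    (I : Set ℝ) (q : ℝ≥0∞) (u : ℝ → X → F) : Prop :=
  AEStronglyMeasurable (Function.uncurry u) ((volume.restrict I).prod volume) ∧
  ∃ C : ℝ≥0, ∀ᵐ t ∂(volume.restrict I), eLpNorm (u t) q volume ≤ C

/-- `u ∈ L^∞_loc (]0, T[; L^q (X))`. -/
def MemLinftylocLp {X F : Type*} [MeasureSpace X] [TopologicalSpace F] [ENorm F]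
    (T : ℝ) (q : ℝ≥0∞) (u : ℝ → X → F) : Prop :=
  ∀ a b : ℝ, 0 < a → b < T → MemLinftyLp (Icc a b) q u

/-- `u ∈ L^∞_loc ([0, T[; L^q (X))`. -/
def MemLinftylocLpFromZero {X F : Type*} [MeasureSpace X] [TopologicalSpace F] [ENorm F]
    (T : ℝ) (q : ℝ≥0∞) (u : ℝ → X → F) : Prop :=
  ∀ b : ℝ, b < T → MemLinftyLp (Icc 0 b) q u

/-- The variation of `u` in the open set `U`:
the supremum of `∫ u ∇·η` over `η ∈ C_c^∞ (U; ℝ³)` with `|η| ≤ 1`. -/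
def variation (u : R3 → ℝ) (U : Set R3) : ℝ≥0∞ :=
  ⨆ (η : R3 → R3) (_ : ContDiff ℝ ∞ η ∧ HasCompactSupport η ∧ tsupport η ⊆ U ∧ ∀ x, ‖η x‖ ≤ 1),
    ENNReal.ofReal (∫ x, u x * divergence η x)

/-- The norm of `BV (U)`. -/
def bvNorm (u : R3 → ℝ) (U : Set R3) : ℝ≥0∞ :=
  eLpNorm u 1 (volume.restrict U) + variation u U

/-- `u ∈ L¹_loc (]0, T[; BV_loc (ℝ³))`. -/
def MemL1locBVloc (T : ℝ) (u : ℝ → R3 → ℝ) : Prop :=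
  AEStronglyMeasurable (Function.uncurry u) ((volume.restrict (Ioo 0 T)).prod volume) ∧
  ∀ a b R : ℝ, 0 < a → b < T → ∫⁻ t in Icc a b, bvNorm (u t) (Metric.ball 0 R) < (⊤ : ℝ≥0∞)

/-- Test functions on `[0, T[ × X`: restrictions of smooth functions on `ℝ × X` whose
(compact) support lies in `]-∞, T[ × X`. They need not vanish at `t = 0`. -/
structure IsTest {X F : Type*} [NormedAddCommGroup X] [NormedSpace ℝ X]
    [NormedAddCommGroup F] [NormedSpace ℝ F] (T : ℝ) (φ : ℝ × X → F) : Prop where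
  smooth : ContDiff ℝ ∞ φ
  compact : HasCompactSupport φ
  supp : tsupport φ ⊆ {z | z.1 < T}

/-- `(f, E, B)` is a weak solution on `[0, T[` of the relativistic Vlasov-Maxwell system with
initial data `(f₀, E₀, B₀)`. -/
structure IsWeakSolution (T : ℝ) (f₀ : R3 × R3 → ℝ) (E₀ B₀ : R3 → R3)
    (f : ℝ → R3 × R3 → ℝ) (E B : ℝ → R3 → R3) : Prop where
  f_nonneg : ∀ᵐ t ∂(volume.restrict (Ico 0 T)), ∀ᵐ z, 0 ≤ f t z
  f_L1 : MemLinftyLp (Ico 0 T) 1 f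
  f_kin : MemLinftyLp (Ico 0 T) 1 fun t z => kin z.2 * f t z
  f_Linfty : MemLinftyLp (Ico 0 T) (⊤ : ℝ≥0∞) f
  E_L2 : MemLinftyLp (Ico 0 T) 2 E
  B_L2 : MemLinftyLp (Ico 0 T) 2 B
  /-- `∂ₜf + v·∇ₓf + K·∇ₚf = 0`, `f(0) = f₀`; the derivative of `φ` in the direction `(1, v, K)`
  is `∂ₜφ + v·∇ₓφ + K·∇ₚφ`. -/
  vlasov : ∀ φ : ℝ × (R3 × R3) → ℝ, IsTest T φ →
    ∫ t in Ico 0 T, ∫ z : R3 × R3,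
        f t z * fderiv ℝ φ (t, z) (1, (velocity z.2, lorentz (E t z.1) (B t z.1) z.2))
      = -∫ z : R3 × R3, f₀ z * φ (0, z)
  /-- `∂ₜE - ∇×B = -4πj`, `E(0) = E₀`. -/
  ampere : ∀ ψ : ℝ × R3 → R3, IsTest T ψ →
    ∫ t in Ico 0 T, ∫ x : R3,
        (inner ℝ (E t x) (fderiv ℝ ψ (t, x) (1, 0))
          + inner ℝ (B t x) (curl (fun y => ψ (t, y)) x)
          - 4 * Real.pi * inner ℝ (currentDensity f t x) (ψ (t, x)))
      = -∫ x : R3, inner ℝ (E₀ x) (ψ (0, x))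
  /-- `∂ₜB + ∇×E = 0`, `B(0) = B₀`. -/
  faraday : ∀ ψ : ℝ × R3 → R3, IsTest T ψ →
    ∫ t in Ico 0 T, ∫ x : R3,
        (inner ℝ (B t x) (fderiv ℝ ψ (t, x) (1, 0))
          - inner ℝ (E t x) (curl (fun y => ψ (t, y)) x))
      = -∫ x : R3, inner ℝ (B₀ x) (ψ (0, x))
  /-- `∇·E = 4πρ`. -/
  gauss_E : ∀ χ : ℝ × R3 → ℝ, IsTest T χ →
    ∫ t in Ico 0 T, ∫ x : R3,
        (fderiv ℝ χ (t, x) (0, E t x) + 4 * Real.pi * chargeDensity f t x * χ (t, x)) = 0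
  /-- `∇·B = 0`. -/
  gauss_B : ∀ χ : ℝ × R3 → ℝ, IsTest T χ →
    ∫ t in Ico 0 T, ∫ x : R3, fderiv ℝ χ (t, x) (0, B t x) = 0

end RVM

end

/-!
Maxwell's equations form a symmetric hyperbolic system with source `-4πj`. Mollify them in `x`,
multiply by the mollified field and integrate: the transport term vanishes by symmetry, and once
`j ∈ L²` the mollification can be removed, so that `d/dt ∫ (|E|² + |B|²) = -8π ∫ E · j`. Testing
Vlasov's equation with truncations of `√(1 + |p|²)` whose gradients stay bounded yields
`d/dt ∬ √(1 + |p|²) f = ∬ f v · K = ∫ E · j`, as `v ⟂ v × B`; here dominated convergence needs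
`f K` to be integrable, that is, again `∫ f dp ∈ L²`. The two work terms then cancel.

The density `∫ f dp` is in `L²` at the times where `∫ |p| ^ l f dp` is: the tail `|p| > 1` is
bounded by the moment, and the squared `L²` norm of the density of `|p| ≤ 1` by a multiple of
`‖f‖_∞ ‖f‖_1`. So `d𝓔/dt = 0` as a distribution on `]0, T[`, and up to the initial time where the
moment bound extends that far. In general `𝓔(0) ≤ c` is weak lower semicontinuity at `t = 0`: both
equations hold with their initial values when tested against functions of `(x, p)` and `x` alone,
and `2 u · ψ ≤ |u|² + |ψ|²` bounds the tested energy at almost every time by `c`.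
-/

noncomputable section

namespace RVM

open Filter Topology Convolution

section CompactSubset

variable {α : Type*} [LinearOrder α] [TopologicalSpace α] {K : Set α}

theorem exists_lt_subset_Iic [ClosedIciTopology α] [NoMinOrder α] {b : α} (hK : IsCompact K)
    (h : K ⊆ Iio b) : ∃ d < b, K ⊆ Iic d := by
  rcases K.eq_empty_or_nonempty with rfl | hne
  · obtain ⟨d, hd⟩ := exists_lt b
    exact ⟨d, hd, empty_subset _⟩
  · obtain ⟨d, hdK, hd⟩ := hK.exists_isGreatest hne
    exact ⟨d, h hdK, hd⟩

theorem exists_gt_subset_Ici [ClosedIicTopology α] [NoMaxOrder α] {a : α} (hK : IsCompact K)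
    (h : K ⊆ Ioi a) : ∃ c > a, K ⊆ Ici c :=
  exists_lt_subset_Iic (α := αᵒᵈ) hK h

end CompactSubset

section DuBoisReymond

variable {a b : ℝ}

theorem contDiff_primitive {ψ : ℝ → ℝ} (hψ : ContDiff ℝ ∞ ψ) (c : ℝ) :
    ContDiff ℝ ∞ fun t => ∫ s in c..t, ψ s :=
  contDiff_infty_iff_deriv.2
    ⟨fun t => (hψ.continuous.integral_hasStrictDerivAt c t).hasDerivAt.differentiableAt,
      by rwa [funext (hψ.continuous.deriv_integral ψ c)]⟩

theorem exists_deriv_eq_of_integral_eq_zero {ψ : ℝ → ℝ} (hψ : ContDiff ℝ ∞ ψ)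
    (hc : HasCompactSupport ψ) (hs : tsupport ψ ⊆ Ioo a b) (h0 : ∫ t, ψ t = 0) :
    ∃ θ : ℝ → ℝ, ContDiff ℝ ∞ θ ∧ HasCompactSupport θ ∧ tsupport θ ⊆ Ioo a b ∧ deriv θ = ψ := by
  obtain ⟨c, hac, hc'⟩ := exists_gt_subset_Ici hc.isCompact fun t ht => (hs ht).1
  obtain ⟨d, hdb, hd'⟩ := exists_lt_subset_Iic hc.isCompact fun t ht => (hs ht).2
  have h_left : ∀ t < c, ∫ s in a..t, ψ s = 0 := fun t ht => by
    refine intervalIntegral.integral_zero_ae (ae_of_all _ fun s hst => ?_)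
    refine image_eq_zero_of_notMem_tsupport fun hs' => ?_
    exact (hst.2.trans_lt (max_lt hac ht)).not_ge (hc' hs')
  have h_right : ∀ t, d < t → ∫ s in a..t, ψ s = 0 := fun t ht => by
    rw [← h0]
    refine intervalIntegral.integral_eq_integral_of_support_subset fun s hs' => ?_
    have hs'' := subset_tsupport ψ hs'
    exact ⟨(hs hs'').1, (mem_Iic.1 (hd' hs'')).trans ht.le⟩
  have h_sub : tsupport (fun t => ∫ s in a..t, ψ s) ⊆ Icc c d :=
    closure_minimal (fun t ht => ⟨not_lt.1 (mt (h_left t) ht), not_lt.1 (mt (h_right t) ht)⟩)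
      isClosed_Icc
  exact ⟨_, contDiff_primitive hψ a, isCompact_Icc.of_isClosed_subset (isClosed_tsupport _) h_sub,
    h_sub.trans (Icc_subset_Ioo hac hdb), funext (hψ.continuous.deriv_integral ψ a)⟩

theorem exists_contDiff_integral_eq_one (hab : a < b) :
    ∃ ψ : ℝ → ℝ, ContDiff ℝ ∞ ψ ∧ HasCompactSupport ψ ∧ tsupport ψ ⊆ Ioo a b ∧ ∫ t, ψ t = 1 := by
  let β : ContDiffBump ((a + b) / 2) :=
    ⟨(b - a) / 8, (b - a) / 4, by linarith, by linarith⟩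
  refine ⟨β.normed volume, β.contDiff_normed, β.hasCompactSupport_normed, ?_, β.integral_normed⟩
  rw [β.tsupport_normed_eq, Real.closedBall_eq_Icc]
  exact Icc_subset_Ioo (by dsimp only [β]; linarith) (by dsimp only [β]; linarith)

theorem integrableOn_mul_of_hasCompactSupport {s : Set ℝ} {ψ h : ℝ → ℝ} (hψ : Continuous ψ)
    (hc : HasCompactSupport ψ) (hh : IntegrableOn h s) : IntegrableOn (fun t => ψ t * h t) s :=
  hh.bdd_mul hψ.aestronglyMeasurable
    (ae_of_all _ (hc.exists_bound_of_continuous hψ).choose_spec)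

theorem setIntegral_mul_eq_integral_of_tsupport_subset {s : Set ℝ} {ψ : ℝ → ℝ}
    (hs : tsupport ψ ⊆ s) (h : ℝ → ℝ) : ∫ t in s, ψ t * h t = ∫ t, ψ t * h t :=
  setIntegral_eq_integral_of_forall_compl_eq_zero fun t ht => by
    rw [image_eq_zero_of_notMem_tsupport fun h' => ht (hs h'), zero_mul]

theorem exists_integral_mul_eq_of_integral_deriv_mul_eq_zero (hab : a < b) {h : ℝ → ℝ}
    (hh : IntegrableOn h (Ioo a b))
    (H : ∀ θ : ℝ → ℝ, ContDiff ℝ ∞ θ → HasCompactSupport θ → tsupport θ ⊆ Ioo a b →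
      ∫ t in Ioo a b, deriv θ t * h t = 0) :
    ∃ c, ∀ ψ : ℝ → ℝ, ContDiff ℝ ∞ ψ → HasCompactSupport ψ → tsupport ψ ⊆ Ioo a b →
      ∫ t in Ioo a b, ψ t * h t = (∫ t, ψ t) * c := by
  obtain ⟨ψ₀, hψ₀, hc₀, hs₀, h_one⟩ := exists_contDiff_integral_eq_one hab
  refine ⟨∫ t in Ioo a b, ψ₀ t * h t, fun ψ hψ hc hs => ?_⟩
  set m := ∫ t, ψ t
  have h_mean : ∫ t, (ψ - fun t => m * ψ₀ t) t = 0 := by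
    simp only [Pi.sub_apply]
    rw [integral_sub (hψ.continuous.integrable_of_hasCompactSupport hc)
        ((hψ₀.continuous.integrable_of_hasCompactSupport hc₀).const_mul m),
      integral_const_mul, h_one, mul_one, sub_self]
  obtain ⟨θ, hθ, hθc, hθs, hθ'⟩ := exists_deriv_eq_of_integral_eq_zero
    (hψ.sub (contDiff_const.mul hψ₀)) (hc.sub hc₀.mul_left)
    ((tsupport_sub _ _).trans
      (union_subset hs ((tsupport_mul_subset_right (f := fun _ => m)).trans hs₀))) h_mean
  have h_zero := H θ hθ hθc hθs
  simp only [hθ', sub_mul, mul_assoc] at h_zero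
  rwa [integral_sub (integrableOn_mul_of_hasCompactSupport hψ.continuous hc hh)
      ((integrableOn_mul_of_hasCompactSupport hψ₀.continuous hc₀ hh).const_mul m),
    integral_const_mul, sub_eq_zero] at h_zero

theorem exists_ae_eq_const_of_integral_deriv_mul_eq_zero (hab : a < b) {h : ℝ → ℝ}
    (hh : IntegrableOn h (Ioo a b))
    (H : ∀ θ : ℝ → ℝ, ContDiff ℝ ∞ θ → HasCompactSupport θ → tsupport θ ⊆ Ioo a b →
      ∫ t in Ioo a b, deriv θ t * h t = 0) :
    ∃ c, ∀ᵐ t ∂(volume.restrict (Ioo a b)), h t = c := by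
  obtain ⟨c, hc⟩ := exists_integral_mul_eq_of_integral_deriv_mul_eq_zero hab hh H
  have h_const : IntegrableOn (fun _ => c) (Ioo a b) := integrableOn_const (by simp)
  have h_ae : ∀ᵐ t, t ∈ Ioo a b → h t - c = 0 := by
    refine isOpen_Ioo.ae_eq_zero_of_integral_contDiff_smul_eq_zero
      (hh.sub h_const).locallyIntegrableOn fun ψ hψ hψc hs => ?_
    simp only [smul_eq_mul]
    rw [← setIntegral_mul_eq_integral_of_tsupport_subset hs fun t => h t - c]
    simp only [mul_sub]
    rw [integral_sub (integrableOn_mul_of_hasCompactSupport hψ.continuous hψc hh)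
        (integrableOn_mul_of_hasCompactSupport hψ.continuous hψc h_const),
      hc ψ hψ hψc hs, setIntegral_mul_eq_integral_of_tsupport_subset hs, integral_mul_const,
      sub_self]
  refine ⟨c, ?_⟩
  rw [ae_restrict_iff' measurableSet_Ioo]
  filter_upwards [h_ae] with t ht ht' using sub_eq_zero.1 (ht ht')

end DuBoisReymond

/-- Test functions of time on `[0, T[`: like the test functions of `IsTest`, they are defined on
all of `ℝ` and need not vanish at `0`. -/
structure IsTimeTest (T : ℝ) (θ : ℝ → ℝ) : Prop where
  smooth : ContDiff ℝ ∞ θ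
  compact : HasCompactSupport θ
  supp : tsupport θ ⊆ Iio T

/-- The weak formulation of the initial value problem `u' = g` on `[0, T[`, `u(0) = u₀`, to which
the evolution equations reduce once they are integrated in all variables except time. -/
def WeakODE (T : ℝ) (u g : ℝ → ℝ) (u₀ : ℝ) : Prop :=
  ∀ θ : ℝ → ℝ, IsTimeTest T θ →
    ∫ t in Ico 0 T, (deriv θ t * u t + θ t * g t) = -(θ 0 * u₀)

section TimeTest

variable {T : ℝ} {θ u : ℝ → ℝ}

theorem exists_isTimeTest_apply_zero_eq_one (hT : 0 < T) : ∃ θ, IsTimeTest T θ ∧ θ 0 = 1 :=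
  have ⟨θ, hs, hc, hθ, _, h_one⟩ :=
    exists_contDiff_tsupport_subset (n := ⊤) (Iio_mem_nhds hT)
  ⟨θ, ⟨hθ, hc, hs⟩, h_one⟩

namespace IsTimeTest

theorem apply_end (hθ : IsTimeTest T θ) : θ T = 0 :=
  image_eq_zero_of_notMem_tsupport fun h => lt_irrefl T (hθ.supp h)

theorem continuous (hθ : IsTimeTest T θ) : Continuous θ :=
  hθ.smooth.continuous

theorem continuous_deriv (hθ : IsTimeTest T θ) : Continuous (deriv θ) :=
  hθ.smooth.continuous_deriv (by simp)

theorem integrableOn_mul (hθ : IsTimeTest T θ) (hu : IntegrableOn u (Ico 0 T)) :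
    IntegrableOn (fun t => θ t * u t) (Ico 0 T) :=
  integrableOn_mul_of_hasCompactSupport hθ.continuous hθ.compact hu

theorem integrableOn_deriv_mul (hθ : IsTimeTest T θ) (hu : IntegrableOn u (Ico 0 T)) :
    IntegrableOn (fun t => deriv θ t * u t) (Ico 0 T) :=
  integrableOn_mul_of_hasCompactSupport hθ.continuous_deriv hθ.compact.deriv hu

end IsTimeTest

theorem exists_ae_eq_const_of_forall_isTimeTest (hT : 0 < T) (hu : IntegrableOn u (Ico 0 T))
    (H : ∀ θ, IsTimeTest T θ → tsupport θ ⊆ Ioo 0 T → ∫ t in Ico 0 T, deriv θ t * u t = 0) :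
    ∃ c, ∀ᵐ t ∂(volume.restrict (Ico 0 T)), u t = c := by
  rw [← restrict_Ioo_eq_restrict_Ico] at *
  exact exists_ae_eq_const_of_integral_deriv_mul_eq_zero hT
    (hu.mono_set Ioo_subset_Ico_self) fun θ hθ hc hs =>
      H θ ⟨hθ, hc, hs.trans Ioo_subset_Iio_self⟩ hs

end TimeTest

namespace WeakODE

variable {T : ℝ} {u g v k : ℝ → ℝ} {u₀ v₀ : ℝ}

theorem congr_ae (H : WeakODE T u g u₀) (huv : ∀ᵐ t ∂(volume.restrict (Ico 0 T)), u t = v t)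
    (hgk : ∀ᵐ t ∂(volume.restrict (Ico 0 T)), g t = k t) : WeakODE T v k u₀ := fun θ hθ => by
  rw [← H θ hθ]
  refine integral_congr_ae ?_
  filter_upwards [huv, hgk] with t h₁ h₂
  rw [h₁, h₂]

theorem const_mul (c : ℝ) (H : WeakODE T u g u₀) :
    WeakODE T (fun t => c * u t) (fun t => c * g t) (c * u₀) := fun θ hθ => by
  rw [mul_left_comm, ← mul_neg, ← H θ hθ, ← integral_const_mul]
  congr with t
  ring

theorem add (hu : IntegrableOn u (Ico 0 T)) (hg : IntegrableOn g (Ico 0 T))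
    (hv : IntegrableOn v (Ico 0 T)) (hk : IntegrableOn k (Ico 0 T))
    (H : WeakODE T u g u₀) (H' : WeakODE T v k v₀) :
    WeakODE T (fun t => u t + v t) (fun t => g t + k t) (u₀ + v₀) := fun θ hθ => by
  have h_add := integral_add ((hθ.integrableOn_deriv_mul hu).add (hθ.integrableOn_mul hg))
    ((hθ.integrableOn_deriv_mul hv).add (hθ.integrableOn_mul hk))
  rw [mul_add, neg_add, ← H θ hθ, ← H' θ hθ]
  refine Eq.trans ?_ h_add
  congr with t
  simp only [Pi.add_apply]
  ring

theorem of_absolutelyContinuousOnInterval (hT : 0 ≤ T)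
    (hu : AbsolutelyContinuousOnInterval u 0 T)
    (hd : ∀ᵐ t ∂(volume.restrict (Ico 0 T)), HasDerivAt u (g t) t) :
    WeakODE T u g (u 0) := fun θ hθ => by
  have h_parts := ((hθ.smooth.of_le (by simp)).contDiffOn.absolutelyContinuousOnInterval
    (a := 0) (b := T)).integral_deriv_mul_eq_sub hu
  rw [hθ.apply_end, intervalIntegral.integral_of_le hT, ← integral_Ico_eq_integral_Ioc, zero_mul,
    zero_sub] at h_parts
  rw [← h_parts]
  refine integral_congr_ae ?_
  filter_upwards [hd] with t ht
  rw [ht.deriv]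

theorem const (hT : 0 ≤ T) (c : ℝ) : WeakODE T (fun _ => c) (fun _ => 0) c :=
  of_absolutelyContinuousOnInterval (u := fun _ => c) hT
    (contDiff_const (n := 1)).contDiffOn.absolutelyContinuousOnInterval
    (ae_of_all _ fun t => hasDerivAt_const t c)

theorem ae_eq_const (hT : 0 < T) (hu : IntegrableOn u (Ico 0 T))
    (H : WeakODE T u (fun _ => 0) u₀) : ∀ᵐ t ∂(volume.restrict (Ico 0 T)), u t = u₀ := by
  obtain ⟨c, hc⟩ := exists_ae_eq_const_of_forall_isTimeTest hT hu fun θ hθ hs => by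
    have h_zero : θ 0 = 0 :=
      image_eq_zero_of_notMem_tsupport fun h => lt_irrefl (0 : ℝ) (hs h).1
    simpa only [mul_zero, add_zero, h_zero, zero_mul, neg_zero] using H θ hθ
  obtain ⟨θ, hθ, h_one⟩ := exists_isTimeTest_apply_zero_eq_one hT
  have h_eq := (H.congr_ae hc (ae_of_all _ fun _ => rfl) θ hθ).symm.trans (const hT.le c θ hθ)
  rw [h_one, one_mul, one_mul, neg_inj] at h_eq
  rwa [h_eq]

theorem absolutelyContinuousOnInterval_primitive (hT : 0 ≤ T) (hg : IntegrableOn g (Ico 0 T))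
    (u₀ : ℝ) : AbsolutelyContinuousOnInterval (fun t => u₀ + ∫ s in (0 : ℝ)..t, g s) 0 T :=
  (contDiff_const (n := 1)).contDiffOn.absolutelyContinuousOnInterval.add
    (((intervalIntegrable_iff_integrableOn_Ico_of_le hT).2
      hg).absolutelyContinuousOnInterval_intervalIntegral (by simp))

theorem ae_hasDerivAt_primitive (hT : 0 ≤ T) (hg : IntegrableOn g (Ico 0 T)) (u₀ : ℝ) :
    ∀ᵐ t ∂(volume.restrict (Ico 0 T)),
      HasDerivAt (fun t => u₀ + ∫ s in (0 : ℝ)..t, g s) (g t) t := by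
  rw [ae_restrict_iff' measurableSet_Ico]
  filter_upwards [((intervalIntegrable_iff_integrableOn_Ico_of_le
    hT).2 hg).ae_hasDerivAt_integral] with t ht htT
  rw [uIcc_of_le hT] at ht
  exact (ht (Ico_subset_Icc_self htT) 0 ⟨le_rfl, hT⟩).const_add u₀

theorem ae_eq_primitive (hT : 0 < T) (hu : IntegrableOn u (Ico 0 T))
    (hg : IntegrableOn g (Ico 0 T)) (H : WeakODE T u g u₀) :
    ∀ᵐ t ∂(volume.restrict (Ico 0 T)), u t = u₀ + ∫ s in (0 : ℝ)..t, g s := by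
  set w : ℝ → ℝ := fun t => u₀ + ∫ s in (0 : ℝ)..t, g s with hw_def
  have hw_ac := absolutelyContinuousOnInterval_primitive hT.le hg u₀
  have hw : WeakODE T w g (w 0) :=
    of_absolutelyContinuousOnInterval hT.le hw_ac (ae_hasDerivAt_primitive hT.le hg u₀)
  have hw_int : IntegrableOn w (Ico 0 T) :=
    (uIcc_of_le hT.le ▸ hw_ac.continuousOn).integrableOn_Icc.mono_set Ico_subset_Icc_self
  have h_sub := add hu hg (hw_int.const_mul (-1)) (hg.const_mul (-1)) H (hw.const_mul (-1))
  have h_init : u₀ + -1 * w 0 = 0 := by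
    simp only [hw_def, intervalIntegral.integral_same]
    ring
  rw [h_init] at h_sub
  filter_upwards [ae_eq_const hT (hu.add (hw_int.const_mul (-1)))
    (h_sub.congr_ae (ae_of_all _ fun _ => rfl) (ae_of_all _ fun t => by ring))] with t ht
  simp only [Pi.add_apply] at ht
  linarith

theorem mul_self (hT : 0 < T) (hu : IntegrableOn u (Ico 0 T)) (hg : IntegrableOn g (Ico 0 T))
    (H : WeakODE T u g u₀) :
    WeakODE T (fun t => u t * u t) (fun t => 2 * (u t * g t)) (u₀ * u₀) := by
  have h_ac := absolutelyContinuousOnInterval_primitive hT.le hg u₀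
  have h_sq := of_absolutelyContinuousOnInterval hT.le (h_ac.mul h_ac) (by
    filter_upwards [ae_hasDerivAt_primitive hT.le hg u₀] with t ht using ht.mul ht)
  simp only [Pi.mul_apply, intervalIntegral.integral_same, add_zero] at h_sq
  have h_prim := H.ae_eq_primitive hT hu hg
  refine h_sq.congr_ae ?_ ?_
  all_goals filter_upwards [h_prim] with t ht
  · rw [Pi.mul_apply, ht]
  · rw [ht]
    ring

theorem integrableOn_mul (hT : 0 < T) (hu : IntegrableOn u (Ico 0 T))
    (hg : IntegrableOn g (Ico 0 T)) (hk : IntegrableOn k (Ico 0 T)) (H : WeakODE T u g u₀) :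
    IntegrableOn (fun t => u t * k t) (Ico 0 T) := by
  obtain ⟨C, hC⟩ := (absolutelyContinuousOnInterval_primitive hT.le hg u₀).exists_bound
  refine hk.bdd_mul (c := C) hu.aestronglyMeasurable ?_
  filter_upwards [H.ae_eq_primitive hT hu hg, ae_restrict_mem measurableSet_Ico] with t ht htT
  rw [ht]
  exact hC t (uIcc_of_le hT.le ▸ Ico_subset_Icc_self htT)

theorem initial_le (hT : 0 < T) (hu : IntegrableOn u (Ico 0 T)) (hg : IntegrableOn g (Ico 0 T))
    (H : WeakODE T u g u₀) {c : ℝ} (hc : ∀ᵐ t ∂(volume.restrict (Ico 0 T)), u t ≤ c) :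
    u₀ ≤ c := by
  by_contra! hlt
  have h_cont := (absolutelyContinuousOnInterval_primitive hT.le hg u₀).continuousOn
  rw [uIcc_of_le hT.le] at h_cont
  have h_gt : ∀ᶠ t in 𝓝[>] 0, c < u₀ + ∫ s in (0 : ℝ)..t, g s := by
    have h_lim := (h_cont 0 ⟨le_rfl, hT.le⟩).mono Ioo_subset_Icc_self
    rw [ContinuousWithinAt, nhdsWithin_Ioo_eq_nhdsGT hT] at h_lim
    exact h_lim.eventually_const_lt (by simpa using hlt)
  obtain ⟨ε, hε, h_gt⟩ := mem_nhdsGT_iff_exists_Ioo_subset.1 h_gt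
  have h_sub : Ioo 0 (min ε T) ⊆ Ico 0 T := fun _ ht =>
    ⟨ht.1.le, ht.2.trans_le (min_le_right _ _)⟩
  have h_false : ∀ᵐ _ ∂(volume.restrict (Ioo 0 (min ε T))), False := by
    filter_upwards [ae_restrict_of_ae_restrict_of_subset h_sub (H.ae_eq_primitive hT hu hg),
      ae_restrict_of_ae_restrict_of_subset h_sub hc, ae_restrict_mem measurableSet_Ioo]
      with _ h_eq h_le ht
    exact ((h_gt ⟨ht.1, ht.2.trans_le (min_le_left _ _)⟩).trans_le (h_eq ▸ h_le)).false
  have : (ae (volume.restrict (Ioo 0 (min ε T)))).NeBot :=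
    ae_restrict_neBot.2 (by simp [mem_Ioi.1 hε, hT])
  exact h_false.exists.elim fun _ h => h

theorem sum {ι : Type*} [Fintype ι] {u g : ι → ℝ → ℝ} {u₀ : ι → ℝ}
    (hu : ∀ i, IntegrableOn (u i) (Ico 0 T)) (hg : ∀ i, IntegrableOn (g i) (Ico 0 T))
    (H : ∀ i, WeakODE T (u i) (g i) (u₀ i)) :
    WeakODE T (fun t => ∑ i, u i t) (fun t => ∑ i, g i t) (∑ i, u₀ i) := fun θ hθ => by
  simp only [Finset.mul_sum, ← Finset.sum_add_distrib, ← Finset.sum_neg_distrib, ← H _ θ hθ]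
  exact integral_finsetSum _ fun i _ =>
    (hθ.integrableOn_deriv_mul (hu i)).add (hθ.integrableOn_mul (hg i))

theorem norm_sq {F : Type*} [NormedAddCommGroup F] [InnerProductSpace ℝ F]
    [FiniteDimensional ℝ F] {u g : ℝ → F} {u₀ : F} (hT : 0 < T) (hu : IntegrableOn u (Ico 0 T))
    (hg : IntegrableOn g (Ico 0 T))
    (H : ∀ w, WeakODE T (fun t => inner ℝ w (u t)) (fun t => inner ℝ w (g t)) (inner ℝ w u₀)) :
    WeakODE T (fun t => ‖u t‖ ^ 2) (fun t => 2 * inner ℝ (u t) (g t)) (‖u₀‖ ^ 2) := by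
  let b := stdOrthonormalBasis ℝ F
  have hu' : ∀ w, IntegrableOn (fun t => inner ℝ w (u t)) (Ico 0 T) := fun w => hu.const_inner w
  have hg' : ∀ w, IntegrableOn (fun t => inner ℝ w (g t)) (Ico 0 T) := fun w => hg.const_inner w
  have h_parseval : ∀ x y : F, inner ℝ x y = ∑ i, inner ℝ (b i) x * inner ℝ (b i) y :=
    fun x y => by
      rw [← b.sum_inner_mul_inner]
      exact Finset.sum_congr rfl fun i _ => by rw [real_inner_comm]
  have h_sum := sum (fun i => (H (b i)).integrableOn_mul hT (hu' _) (hg' _) (hu' _))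
    (fun i => ((H (b i)).integrableOn_mul hT (hu' _) (hg' _) (hg' _)).const_mul 2)
    fun i => (H (b i)).mul_self hT (hu' _) (hg' _)
  simpa only [← Finset.mul_sum, ← h_parseval, real_inner_self_eq_norm_sq] using h_sum

end WeakODE

section SquareIntegrable

variable {X F : Type*} [MeasurableSpace X] {μ : Measure X} [NormedAddCommGroup F] {u w : X → F}

theorem eLpNorm_two_sq {ε : Type*} [TopologicalSpace ε] [ESeminormedAddMonoid ε] (u : X → ε) :
    eLpNorm u 2 μ ^ 2 = ∫⁻ x, ‖u x‖ₑ ^ 2 ∂μ := by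
  simpa using eLpNorm_nnreal_pow_eq_lintegral (f := u) (μ := μ) (p := 2) two_ne_zero

theorem integral_norm_sq_eq_toReal (hu : AEStronglyMeasurable u μ) :
    ∫ x, ‖u x‖ ^ 2 ∂μ = (eLpNorm u 2 μ ^ 2).toReal := by
  rw [eLpNorm_two_sq, integral_eq_lintegral_of_nonneg_ae (f := fun x => ‖u x‖ ^ 2)
    (ae_of_all _ fun x => by positivity) (hu.norm.pow 2)]
  simp only [ENNReal.ofReal_pow (norm_nonneg _), ofReal_norm]

theorem lintegral_mul_sq_le {k v : X → ℝ≥0∞} (hk : AEMeasurable k μ) (hv : AEMeasurable v μ) :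
    (∫⁻ x, k x * v x ∂μ) ^ 2 ≤ (∫⁻ x, k x ∂μ) * ∫⁻ x, k x * v x ^ 2 ∂μ := by
  have h_sqrt : ∀ a : ℝ≥0∞, (a ^ (1 / 2 : ℝ)) ^ 2 = a := fun a => by
    rw [← ENNReal.rpow_mul_natCast]; norm_num
  have h_cs := ENNReal.lintegral_mul_le_Lp_mul_Lq μ Real.HolderConjugate.two_two
    (hk.pow_const (1 / 2 : ℝ)) ((hk.pow_const (1 / 2 : ℝ)).mul hv)
  simp only [Pi.mul_apply, ← mul_assoc, ← sq, ENNReal.rpow_two, mul_pow, h_sqrt] at h_cs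
  refine (pow_le_pow_left' h_cs 2).trans_eq ?_
  rw [mul_pow, h_sqrt, h_sqrt]

variable [InnerProductSpace ℝ F]

theorem abs_integral_inner_le (hu : MemLp u 2 μ) (hw : MemLp w 2 μ) :
    |∫ x, inner ℝ (u x) (w x) ∂μ| ≤ (∫ x, ‖u x‖ ^ 2 ∂μ) + ∫ x, ‖w x‖ ^ 2 ∂μ := by
  have hu_sq : Integrable (fun x => ‖u x‖ ^ 2) μ := hu.integrable_norm_pow two_ne_zero
  have hw_sq : Integrable (fun x => ‖w x‖ ^ 2) μ := hw.integrable_norm_pow two_ne_zero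
  rw [← integral_add hu_sq hw_sq, ← Real.norm_eq_abs]
  refine norm_integral_le_of_norm_le (g := fun x => ‖u x‖ ^ 2 + ‖w x‖ ^ 2) (hu_sq.add hw_sq)
    (ae_of_all _ fun x => ?_)
  refine (norm_inner_le_norm (𝕜 := ℝ) (E := F) (u x) (w x)).trans ?_
  nlinarith [two_mul_le_add_sq ‖u x‖ ‖w x‖, norm_nonneg (u x), norm_nonneg (w x)]

theorem integrable_inner_of_memLp_two (hu : MemLp u 2 μ) (hw : MemLp w 2 μ) :
    Integrable (fun x => inner ℝ (u x) (w x)) μ :=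
  (hu.norm.integrable_mul hw.norm).mono' (hu.1.inner hw.1)
    (ae_of_all _ fun x => norm_inner_le_norm (u x) (w x))

theorem integral_inner_eq_integral_norm_sq (hu : MemLp u 2 μ) (hw : MemLp w 2 μ) :
    ∫ x, inner ℝ (u x) (w x) ∂μ
      = ((∫ x, ‖u x + w x‖ ^ 2 ∂μ) - (∫ x, ‖u x‖ ^ 2 ∂μ) - ∫ x, ‖w x‖ ^ 2 ∂μ) / 2 := by
  have h_u : Integrable (fun x => ‖u x‖ ^ 2) μ := hu.integrable_norm_pow two_ne_zero
  have h_w : Integrable (fun x => ‖w x‖ ^ 2) μ := hw.integrable_norm_pow two_ne_zero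
  have h_add : Integrable (fun x => ‖u x + w x‖ ^ 2) μ :=
    (hu.add hw).integrable_norm_pow two_ne_zero
  have h_sub : Integrable (fun x => ‖u x + w x‖ ^ 2 - ‖u x‖ ^ 2) μ := h_add.sub h_u
  rw [← integral_sub h_add h_u, ← integral_sub h_sub h_w, ← integral_div]
  congr with x
  rw [norm_add_sq_real]
  ring

end SquareIntegrable

section Convolution

variable {V F : Type*} [NormedAddCommGroup V] [InnerProductSpace ℝ V] [FiniteDimensional ℝ V]
  [MeasurableSpace V] [BorelSpace V] [NormedAddCommGroup F] [NormedSpace ℝ F]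
  {κ : V → ℝ} {u : V → F}

theorem enorm_convolution_le (κ : V → ℝ) (u : V → F) (y : V) :
    ‖(κ ⋆ u) y‖ₑ ≤ ∫⁻ x, ‖κ (y - x)‖ₑ * ‖u x‖ₑ := by
  rw [convolution_lsmul_swap]
  exact (enorm_integral_le_lintegral_enorm _).trans_eq (by simp only [enorm_smul])

theorem enorm_convolution_le_eLpNorm_mul_eLpNorm {p q : ℝ≥0∞} [ENNReal.HolderTriple p q 1]
    (hκ : AEStronglyMeasurable κ) (hu : AEStronglyMeasurable u) (y : V) :
    ‖(κ ⋆ u) y‖ₑ ≤ eLpNorm κ p volume * eLpNorm u q volume := by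
  have h_refl : MeasurePreserving (fun x => y - x) := Measure.measurePreserving_sub_left volume y
  rw [← eLpNorm_comp_measurePreserving hκ h_refl]
  refine (enorm_convolution_le κ u y).trans ?_
  refine le_of_eq_of_le ?_ (eLpNorm_smul_le_mul_eLpNorm (r := 1) hu
    (hκ.comp_measurePreserving h_refl))
  simp only [eLpNorm_one_eq_lintegral_enorm, Pi.smul_apply', Function.comp_apply, enorm_smul]

theorem eLpNorm_two_convolution_le (hκ : AEStronglyMeasurable κ) (hκ' : eLpNorm κ 1 volume ≠ ⊤)
    (hu : AEStronglyMeasurable u) :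
    eLpNorm (κ ⋆ u) 2 volume ≤ eLpNorm κ 1 volume * eLpNorm u 2 volume := by
  rw [← ENNReal.pow_le_pow_left_iff two_ne_zero, mul_pow, eLpNorm_two_sq, eLpNorm_two_sq]
  set k : ℝ≥0∞ := eLpNorm κ 1 volume with hk
  rw [eLpNorm_one_eq_lintegral_enorm] at hk
  have h_cs : ∀ y, ‖(κ ⋆ u) y‖ₑ ^ 2 ≤ k * ∫⁻ x, ‖κ (y - x)‖ₑ * ‖u x‖ₑ ^ 2 := fun y => by
    have hκy : AEMeasurable (fun x => ‖κ (y - x)‖ₑ) :=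
      (hκ.comp_measurePreserving (Measure.measurePreserving_sub_left volume y)).enorm
    refine (pow_le_pow_left' (enorm_convolution_le κ u y) 2).trans ?_
    refine (lintegral_mul_sq_le hκy hu.enorm).trans_eq ?_
    rw [lintegral_sub_left_eq_self (fun x => ‖κ x‖ₑ) y, hk]
  have h_meas : AEMeasurable (fun z : V × V => ‖κ (z.1 - z.2)‖ₑ * ‖u z.2‖ₑ ^ 2) :=
    (hκ.comp_quasiMeasurePreserving
      (quasiMeasurePreserving_sub_of_right_invariant volume volume)).enorm.mul
      ((hu.enorm.pow_const 2).comp_quasiMeasurePreserving Measure.quasiMeasurePreserving_snd)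
  calc ∫⁻ y, ‖(κ ⋆ u) y‖ₑ ^ 2
      ≤ ∫⁻ y, k * ∫⁻ x, ‖κ (y - x)‖ₑ * ‖u x‖ₑ ^ 2 := lintegral_mono h_cs
    _ = k * ∫⁻ x, ∫⁻ y, ‖κ (y - x)‖ₑ * ‖u x‖ₑ ^ 2 := by
        rw [lintegral_const_mul' _ _ hκ', lintegral_lintegral_swap h_meas]
    _ = k * ∫⁻ x, k * ‖u x‖ₑ ^ 2 := by
        congr with x
        rw [lintegral_mul_const' _ _ (by finiteness),
          lintegral_sub_right_eq_self (fun x => ‖κ x‖ₑ) x, hk]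
    _ = k ^ 2 * ∫⁻ x, ‖u x‖ₑ ^ 2 := by
        rw [lintegral_const_mul' _ _ hκ', sq, mul_assoc]

theorem aestronglyMeasurable_uncurry_convolution {α : Type*} [MeasurableSpace α] {ν : Measure α}
    [SFinite ν] {v : α → V → F} (hκ : Continuous κ)
    (hv : AEStronglyMeasurable (Function.uncurry v) (ν.prod volume)) :
    AEStronglyMeasurable (Function.uncurry fun t => κ ⋆ v t) (ν.prod volume) := by
  have h_meas := hv.stronglyMeasurable_mk
  set v' : α → V → F := fun t x => hv.mk _ (t, x)
  have h_conv : StronglyMeasurable fun z : α × V => ∫ x, κ (z.2 - x) • v' z.1 x := by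
    refine StronglyMeasurable.integral_prod_right
      (f := fun (z : α × V) (x : V) => κ (z.2 - x) • v' z.1 x) ?_
    have h_ker : StronglyMeasurable fun q : (α × V) × V => κ (q.1.2 - q.2) :=
      hκ.stronglyMeasurable.comp_measurable (by fun_prop)
    exact h_ker.smul (h_meas.comp_measurable (g := fun q : (α × V) × V => (q.1.1, q.2))
      (by fun_prop))
  refine ⟨_, h_conv, ?_⟩
  have h_ae : ∀ᵐ t ∂ν, v t =ᵐ[volume] v' t := Measure.ae_ae_of_ae_prod hv.ae_eq_mk
  filter_upwards [Measure.quasiMeasurePreserving_fst.ae h_ae] with z hz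
  rw [Function.uncurry, convolution_lsmul_swap]
  refine integral_congr_ae ?_
  filter_upwards [hz] with x hx
  rw [hx]

theorem aestronglyMeasurable_convolution_apply {α : Type*} [MeasurableSpace α] {ν : Measure α}
    [SFinite ν] {v : α → V → F} (hκ : Continuous κ)
    (hv : AEStronglyMeasurable (Function.uncurry v) (ν.prod volume)) (y : V) :
    AEStronglyMeasurable (fun t => (κ ⋆ v t) y) ν := by
  simp only [convolution_lsmul_swap]
  have h_ker : StronglyMeasurable fun z : α × V => κ (y - z.2) :=
    hκ.stronglyMeasurable.comp_measurable (by fun_prop)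
  exact (h_ker.aestronglyMeasurable.smul hv).integral_prod_right'

theorem hasLineDerivAt_convolution (hκ : ContDiff ℝ ∞ κ) (hc : HasCompactSupport κ)
    (hu : LocallyIntegrable u) (y e : V) :
    HasLineDerivAt ℝ (κ ⋆ u) (((fun x => fderiv ℝ κ x e) ⋆ u) y) y e := by
  have h := (hc.hasFDerivAt_convolution_left (ContinuousLinearMap.lsmul ℝ ℝ)
    (hκ.of_le (by simp)) hu y).hasLineDerivAt e
  have h_int := (hc.fderiv ℝ).convolutionExists_left ((ContinuousLinearMap.lsmul ℝ ℝ).precompL V)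
    (hκ.continuous_fderiv (by simp)) hu y
  rwa [convolution_def, ContinuousLinearMap.integral_apply h_int] at h

theorem memLp_two_convolution (hκ : ContDiff ℝ ∞ κ) (hc : HasCompactSupport κ)
    (hu : MemLp u 2) : MemLp (κ ⋆ u) 2 := by
  have hκ' : MemLp κ 1 := hκ.continuous.memLp_of_hasCompactSupport hc
  refine ⟨?_, (eLpNorm_two_convolution_le hκ'.1 hκ'.2.ne hu.1).trans_lt
    (ENNReal.mul_lt_top hκ'.2 hu.2)⟩
  exact (hc.continuous_convolution_left _ hκ.continuous
    (hu.locallyIntegrable (by norm_num))).aestronglyMeasurable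

end Convolution

section IntegrationByParts

variable {V F : Type*} [NormedAddCommGroup V] [InnerProductSpace ℝ V] [FiniteDimensional ℝ V]
  [MeasurableSpace V] [BorelSpace V] [NormedAddCommGroup F] [InnerProductSpace ℝ F]

theorem integral_inner_apply_lineDeriv_eq_zero {v v' : V → F} {e : V} {A : F →L[ℝ] F}
    (hA : (A : F →ₗ[ℝ] F).IsSymmetric) (hv : MemLp v 2) (hv' : MemLp v' 2)
    (h : ∀ x, HasLineDerivAt ℝ v (v' x) x e) : ∫ x, inner ℝ (v x) (A (v' x)) = 0 := by
  have h_parts := integral_bilinear_hasLineDerivAt_right_eq_neg_left_of_integrable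
    (μ := volume) (B := (innerSL ℝ).flip.comp A)
    (integrable_inner_of_memLp_two hv (A.comp_memLp' hv'))
    (integrable_inner_of_memLp_two hv' (A.comp_memLp' hv))
    (integrable_inner_of_memLp_two hv (A.comp_memLp' hv)) (fun x _ => h x) fun x _ => h x
  have h_symm : ∀ x, inner ℝ (v' x) (A (v x)) = inner ℝ (v x) (A (v' x)) := fun x =>
    (hA _ _).symm.trans (real_inner_comm _ _)
  refine self_eq_neg.1 (Eq.trans ?_ h_parts)
  exact integral_congr_ae (ae_of_all _ fun x => (h_symm x).symm)

end IntegrationByParts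

section Mollifier

variable {V F : Type*} [NormedAddCommGroup V]

/-- The bump functions behind the standard mollifier; the outer radius is twice the inner one, as
Lebesgue differentiation along them requires a bounded ratio. -/
def mollifierBump (n : ℕ) : ContDiffBump (0 : V) :=
  ⟨1 / (n + 1), 2 / (n + 1), by positivity, by gcongr; norm_num⟩

theorem tendsto_rOut_mollifierBump :
    Tendsto (fun n => (mollifierBump n : ContDiffBump (0 : V)).rOut) atTop (𝓝 0) := by
  have h := tendsto_one_div_add_atTop_nhds_zero_nat.const_mul (2 : ℝ)
  simpa only [mul_one_div, mul_zero, mollifierBump] using h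

variable [InnerProductSpace ℝ V] [FiniteDimensional ℝ V] [MeasurableSpace V] [BorelSpace V]

/-- The standard mollifier: smooth, nonnegative, of integral one, and supported in the ball of
radius `2 / (n + 1)`. -/
def mollifier (n : ℕ) : V → ℝ := (mollifierBump n).normed volume

theorem contDiff_mollifier (n : ℕ) : ContDiff ℝ ∞ (mollifier n : V → ℝ) :=
  (mollifierBump n).contDiff_normed

theorem hasCompactSupport_mollifier (n : ℕ) : HasCompactSupport (mollifier n : V → ℝ) :=
  (mollifierBump n).hasCompactSupport_normed

theorem eLpNorm_one_mollifier (n : ℕ) : eLpNorm (mollifier n : V → ℝ) 1 volume = 1 := by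
  have h_int : Integrable (mollifier n : V → ℝ) := (mollifierBump n).integrable_normed
  have h_norm : ∫ x : V, ‖mollifier n x‖ = 1 := by
    rw [← (mollifierBump n : ContDiffBump (0 : V)).integral_normed (μ := volume)]
    exact integral_congr_ae
      (ae_of_all _ fun x => Real.norm_of_nonneg ((mollifierBump n).nonneg_normed x))
  rw [← ofReal_lpNorm (memLp_one_iff_integrable.2 h_int), lpNorm_one_eq_integral_norm h_int.1,
    h_norm, ENNReal.ofReal_one]

variable [NormedAddCommGroup F] [InnerProductSpace ℝ F] {u w : V → F}

theorem memLp_two_mollifier_convolution (hu : MemLp u 2) (n : ℕ) : MemLp (mollifier n ⋆ u) 2 :=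
  memLp_two_convolution (contDiff_mollifier n) (hasCompactSupport_mollifier n) hu

theorem eLpNorm_two_mollifier_convolution_le (hu : MemLp u 2) (n : ℕ) :
    eLpNorm (mollifier n ⋆ u) 2 volume ≤ eLpNorm u 2 volume := by
  have h := eLpNorm_two_convolution_le (κ := mollifier n)
    (contDiff_mollifier n).continuous.aestronglyMeasurable (by simp [eLpNorm_one_mollifier]) hu.1
  rwa [eLpNorm_one_mollifier, one_mul] at h

theorem integral_norm_sq_mollifier_convolution_le (hu : MemLp u 2) (n : ℕ) :
    ∫ y, ‖(mollifier n ⋆ u) y‖ ^ 2 ≤ ∫ x, ‖u x‖ ^ 2 := by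
  rw [integral_norm_sq_eq_toReal (memLp_two_mollifier_convolution hu n).1,
    integral_norm_sq_eq_toReal hu.1]
  exact ENNReal.toReal_mono (ENNReal.pow_ne_top hu.2.ne)
    (pow_le_pow_left' (eLpNorm_two_mollifier_convolution_le hu n) 2)

theorem norm_mul_integral_norm_sq_add_inner_mollifier_le {a C D M : ℝ} (hu : MemLp u 2)
    (hw : MemLp w 2) (ha : ‖a‖ ≤ M) (hC : ∫ x, ‖u x‖ ^ 2 ≤ C) (hD : ∫ x, ‖w x‖ ^ 2 ≤ D) (n : ℕ) :
    ‖a * (∫ y, ‖(mollifier n ⋆ u) y‖ ^ 2)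
      + 2 * ∫ y, inner ℝ ((mollifier n ⋆ u) y) ((mollifier n ⋆ w) y)‖ ≤ M * C + 2 * (C + D) := by
  have hu_sq := (integral_norm_sq_mollifier_convolution_le hu n).trans hC
  have hw_sq := (integral_norm_sq_mollifier_convolution_le hw n).trans hD
  have h_inner := abs_integral_inner_le (memLp_two_mollifier_convolution hu n)
    (memLp_two_mollifier_convolution hw n)
  refine (norm_add_le _ _).trans ?_
  rw [norm_mul, norm_mul, Real.norm_two,
    Real.norm_of_nonneg (by positivity : 0 ≤ ∫ y, ‖(mollifier n ⋆ u) y‖ ^ 2)]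
  gcongr
  · exact (norm_nonneg a).trans ha
  · exact h_inner.trans (add_le_add hu_sq hw_sq)

variable [CompleteSpace F]

theorem tendsto_eLpNorm_two_mollifier_convolution (hu : MemLp u 2) :
    Tendsto (fun n => eLpNorm (mollifier n ⋆ u) 2 volume) atTop (𝓝 (eLpNorm u 2 volume)) := by
  have h_ae : ∀ᵐ x, Tendsto (fun n => (mollifier n ⋆ u) x) atTop (𝓝 (u x)) :=
    ContDiffBump.ae_convolution_tendsto_right_of_locallyIntegrable (K := 2)
      tendsto_rOut_mollifierBump
      (Eventually.of_forall fun n => by simp only [mollifierBump, mul_one_div, le_refl])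
      (hu.locallyIntegrable (by norm_num))
  refine tendsto_of_le_liminf_of_limsup_le ?_ ?_
  · exact Lp.eLpNorm_lim_le_liminf_eLpNorm
      (fun n => (memLp_two_mollifier_convolution hu n).1) u h_ae
  · exact limsup_le_of_le (by isBoundedDefault)
      (Eventually.of_forall fun n => eLpNorm_two_mollifier_convolution_le hu n)

theorem tendsto_integral_norm_sq_mollifier_convolution (hu : MemLp u 2) :
    Tendsto (fun n => ∫ y, ‖(mollifier n ⋆ u) y‖ ^ 2) atTop (𝓝 (∫ x, ‖u x‖ ^ 2)) := by
  simp only [integral_norm_sq_eq_toReal hu.1,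
    fun n => integral_norm_sq_eq_toReal (memLp_two_mollifier_convolution hu n).1]
  exact (ENNReal.tendsto_toReal (ENNReal.pow_ne_top hu.2.ne)).comp
    ((ENNReal.continuous_pow 2).tendsto _ |>.comp (tendsto_eLpNorm_two_mollifier_convolution hu))

theorem tendsto_integral_inner_mollifier_convolution (hu : MemLp u 2) (hw : MemLp w 2) :
    Tendsto (fun n => ∫ y, inner ℝ ((mollifier n ⋆ u) y) ((mollifier n ⋆ w) y)) atTop
      (𝓝 (∫ x, inner ℝ (u x) (w x))) := by
  have h_exists : ∀ {v : V → F}, MemLp v 2 → ∀ n : ℕ, ConvolutionExists (mollifier n) v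
      (ContinuousLinearMap.lsmul ℝ ℝ) := fun hv n =>
    (hasCompactSupport_mollifier n).convolutionExists_left _ (contDiff_mollifier n).continuous
      (hv.locallyIntegrable (by norm_num))
  rw [integral_inner_eq_integral_norm_sq hu hw]
  refine (((tendsto_integral_norm_sq_mollifier_convolution (hu.add hw)).sub
    (tendsto_integral_norm_sq_mollifier_convolution hu)).sub
    (tendsto_integral_norm_sq_mollifier_convolution hw)).div_const 2 |>.congr fun n => ?_
  rw [integral_inner_eq_integral_norm_sq (memLp_two_mollifier_convolution hu n)
    (memLp_two_mollifier_convolution hw n), (h_exists hu n).distrib_add (h_exists hw n)]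
  rfl

end Mollifier

namespace MemLinftyLp

variable {X F : Type*} [MeasureSpace X] [NormedAddCommGroup F] {I : Set ℝ} {p q r : ℝ≥0∞}
  {u w : ℝ → X → F}

theorem ae_memLp [SFinite (volume : Measure X)] (hu : MemLinftyLp I q u) :
    ∀ᵐ t ∂(volume.restrict I), MemLp (u t) q := by
  obtain ⟨h_meas, C, hC⟩ := hu
  filter_upwards [h_meas.prodMk_left, hC] with t h_meas_t hCt
  exact ⟨h_meas_t, hCt.trans_lt ENNReal.coe_lt_top⟩

theorem integrable_prod [SFinite (volume : Measure X)] [IsFiniteMeasure (volume.restrict I)]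
    (hu : MemLinftyLp I 1 u) :
    Integrable (Function.uncurry u) ((volume.restrict I).prod volume) := by
  obtain ⟨C, hC⟩ := hu.2
  refine ⟨hu.1, ?_⟩
  rw [HasFiniteIntegral, lintegral_prod _ hu.1.enorm]
  simp only [eLpNorm_one_eq_lintegral_enorm] at hC
  refine (lintegral_mono_ae hC).trans_lt ?_
  rw [lintegral_const]
  finiteness

theorem comp_clm {G : Type*} [NormedAddCommGroup G] [NormedSpace ℝ F] [NormedSpace ℝ G]
    (A : F →L[ℝ] G) (hu : MemLinftyLp I q u) : MemLinftyLp I q fun t x => A (u t x) := by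
  obtain ⟨h_meas, C, hC⟩ := hu
  refine ⟨A.continuous.comp_aestronglyMeasurable h_meas, ‖A‖₊ * C, ?_⟩
  filter_upwards [hC] with t hCt
  refine (eLpNorm_le_nnreal_smul_eLpNorm_of_ae_le_mul
    (ae_of_all _ fun x => A.le_opNNNorm (u t x)) q).trans ?_
  rw [ENNReal.smul_def, smul_eq_mul, ENNReal.coe_mul]
  gcongr

theorem sum {ι : Type*} [Fintype ι] [SFinite (volume : Measure X)] (hq : 1 ≤ q)
    {u : ι → ℝ → X → F} (hu : ∀ k, MemLinftyLp I q (u k)) :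
    MemLinftyLp I q fun t x => ∑ k, u k t x := by
  choose h_meas C hC using hu
  refine ⟨?_, ∑ k, C k, ?_⟩
  · exact Finset.aestronglyMeasurable_fun_sum _ fun k _ => h_meas k
  · filter_upwards [ae_all_iff.2 hC, ae_all_iff.2 fun k => (h_meas k).prodMk_left]
      with t hCt h_meas_t
    have h_eq : (fun x => ∑ k, u k t x) = ∑ k, u k t := by ext x; simp
    rw [h_eq, ENNReal.ofNNReal_finsetSum]
    exact (eLpNorm_sum_le (fun k _ => h_meas_t k) hq).trans (Finset.sum_le_sum fun k _ => hCt k)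

theorem smul_of_hasCompactSupport [NormedSpace ℝ F] {θ : ℝ → ℝ} (hθ : Continuous θ)
    (hc : HasCompactSupport θ) (hu : MemLinftyLp I q u) :
    MemLinftyLp I q fun t x => θ t • u t x := by
  obtain ⟨M, hM⟩ := hθ.bounded_above_of_compact_support hc
  obtain ⟨h_meas, C, hC⟩ := hu
  refine ⟨(hθ.aestronglyMeasurable.comp_fst).smul h_meas, M.toNNReal * C, ?_⟩
  filter_upwards [hC] with t hCt
  change eLpNorm (θ t • u t) q volume ≤ _
  rw [eLpNorm_const_smul, ENNReal.coe_mul]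
  gcongr
  rw [enorm_le_coe, ← NNReal.coe_le_coe, coe_nnnorm]
  exact (hM t).trans (Real.le_coe_toNNReal M)

theorem exists_integral_norm_sq_le [SFinite (volume : Measure X)] (hu : MemLinftyLp I 2 u) :
    ∃ C : ℝ, ∀ᵐ t ∂(volume.restrict I), ∫ x, ‖u t x‖ ^ 2 ≤ C := by
  obtain ⟨C, hC⟩ := hu.2
  refine ⟨C ^ 2, ?_⟩
  filter_upwards [hC, hu.ae_memLp] with t hCt hut
  rw [integral_norm_sq_eq_toReal hut.1, ENNReal.toReal_pow]
  gcongr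
  exact ENNReal.toReal_le_coe_of_le_coe hCt

theorem inner_of_holderTriple [SFinite (volume : Measure X)] [InnerProductSpace ℝ F]
    [ENNReal.HolderTriple p q r] (hu : MemLinftyLp I p u) (hw : MemLinftyLp I q w) :
    MemLinftyLp I r fun t x => inner ℝ (u t x) (w t x) := by
  obtain ⟨C, hC⟩ := hu.2
  obtain ⟨D, hD⟩ := hw.2
  refine ⟨hu.1.inner hw.1, C * D, ?_⟩
  filter_upwards [hC, hD, hu.ae_memLp, hw.ae_memLp] with t hCt hDt hut hwt
  have h_holder := eLpNorm_le_eLpNorm_mul_eLpNorm_of_nnnorm (p := p) (q := q) (r := r)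
    hut.1 hwt.1
    (fun x y => inner ℝ x y) 1 (ae_of_all _ fun x => by
      simpa using nnnorm_inner_le_nnnorm (𝕜 := ℝ) (u t x) (w t x))
  refine h_holder.trans ?_
  rw [ENNReal.coe_one, one_mul, ENNReal.coe_mul]
  gcongr

section Convolution

variable {V : Type*} [NormedAddCommGroup V] [InnerProductSpace ℝ V] [FiniteDimensional ℝ V]
  [MeasurableSpace V] [BorelSpace V] [NormedSpace ℝ F] {κ : V → ℝ} {u : ℝ → V → F}

theorem convolution (hκ : Continuous κ) (hκ' : MemLp κ 1) (hu : MemLinftyLp I 2 u) :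
    MemLinftyLp I 2 fun t => κ ⋆ u t := by
  obtain ⟨C, hC⟩ := hu.2
  refine ⟨aestronglyMeasurable_uncurry_convolution hκ hu.1, (eLpNorm κ 1 volume).toNNReal * C, ?_⟩
  filter_upwards [hC, hu.ae_memLp] with t hCt hut
  rw [ENNReal.coe_mul, ENNReal.coe_toNNReal hκ'.2.ne]
  refine (eLpNorm_two_convolution_le hκ'.1 hκ'.2.ne hut.1).trans ?_
  gcongr

theorem integrable_convolution_apply [IsFiniteMeasure (volume.restrict I)]
    [ENNReal.HolderTriple p q 1] (hκ : Continuous κ) (hκ' : MemLp κ p) (hu : MemLinftyLp I q u)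
    (y : V) : Integrable (fun t => (κ ⋆ u t) y) (volume.restrict I) := by
  obtain ⟨C, hC⟩ := hu.2
  refine .of_bound (aestronglyMeasurable_convolution_apply hκ hu.1 y)
    ((eLpNorm κ p volume).toReal * C) ?_
  filter_upwards [hC, hu.ae_memLp] with t hCt hut
  rw [← toReal_enorm, ← ENNReal.coe_toReal, ← ENNReal.toReal_mul]
  refine ENNReal.toReal_mono (ENNReal.mul_ne_top hκ'.2.ne ENNReal.coe_ne_top) ?_
  refine (enorm_convolution_le_eLpNorm_mul_eLpNorm (p := p) (q := q) hκ'.1 hut.1 y).trans ?_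
  gcongr

end Convolution

end MemLinftyLp

theorem contDiff_fderiv_apply {V F : Type*} [NormedAddCommGroup V] [NormedSpace ℝ V]
    [NormedAddCommGroup F] [NormedSpace ℝ F] {g : V → F} (hg : ContDiff ℝ ∞ g) (e : V) :
    ContDiff ℝ ∞ fun x => fderiv ℝ g x e :=
  (hg.fderiv_right (by simp)).clm_apply contDiff_const

section KernelDerivative

variable {V F : Type*} [NormedAddCommGroup V] [NormedSpace ℝ V] [NormedAddCommGroup F]
  [NormedSpace ℝ F] {κ : V → ℝ}

theorem fderiv_comp_sub_left_smul (hκ : ContDiff ℝ ∞ κ) (w : F) (x y e : V) :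
    fderiv ℝ (fun x => κ (y - x) • w) x e = -fderiv ℝ κ (y - x) e • w := by
  have h := ((hκ.differentiable (by simp) (y - x)).hasFDerivAt.comp x
    ((hasFDerivAt_id x).const_sub y)).smul_const w
  have h' : fderiv ℝ (fun x => κ (y - x) • w) x = _ := h.fderiv
  rw [h']
  simp

theorem memLp_fderiv_apply [MeasurableSpace V] [OpensMeasurableSpace V] {μ : Measure V}
    [IsFiniteMeasureOnCompacts μ] (hκ : ContDiff ℝ ∞ κ) (hc : HasCompactSupport κ) (e : V)
    (p : ℝ≥0∞) : MemLp (fun x => fderiv ℝ κ x e) p μ :=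
  (contDiff_fderiv_apply hκ e).continuous.memLp_of_hasCompactSupport (hc.fderiv_apply ℝ e)

end KernelDerivative

section WeakSystem

variable {V F ι : Type*} [Fintype ι] [NormedAddCommGroup V] [InnerProductSpace ℝ V]
  [FiniteDimensional ℝ V] [MeasurableSpace V] [BorelSpace V] [NormedAddCommGroup F]
  [InnerProductSpace ℝ F]

/-- The weak formulation of the first order system `∂ₜu + ∑ₖ Aₖ ∂_{eₖ} u = J` on `[0, T[ × V`,
`u(0) = u₀`, with symmetric matrices `Aₖ`, tested against products `θ(t) ψ(x)`. Symmetry lets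
`Aₖ` act on `ψ`. -/
def WeakSystem (T : ℝ) (e : ι → V) (A : ι → F →L[ℝ] F) (u J : ℝ → V → F) (u₀ : V → F) : Prop :=
  ∀ ψ : V → F, ContDiff ℝ ∞ ψ → HasCompactSupport ψ →
    WeakODE T (fun t => ∫ x, inner ℝ (u t x) (ψ x))
      (fun t => ∫ x, (inner ℝ (u t x) (∑ k, A k (fderiv ℝ ψ x (e k))) + inner ℝ (J t x) (ψ x)))
      (∫ x, inner ℝ (u₀ x) (ψ x))

/-- The mollification of `∑ₖ Aₖ ∂_{eₖ} v`, with the derivatives on the kernel `κ`. -/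
def mollifiedTransport (e : ι → V) (A : ι → F →L[ℝ] F) (κ : V → ℝ) (v : V → F) (y : V) : F :=
  ∑ k, A k (((fun x => fderiv ℝ κ x (e k)) ⋆ v) y)

variable {T : ℝ} {e : ι → V} {A : ι → F →L[ℝ] F} {u J : ℝ → V → F}
  {u₀ v : V → F} {κ : V → ℝ} {θ : ℝ → ℝ}

theorem integrable_inner_kernel_smul (hκ : Continuous κ) (hc : HasCompactSupport κ)
    (hv : LocallyIntegrable v) (a : F) (y : V) :
    Integrable fun x => inner ℝ (v x) (κ (y - x) • a) := by
  have h_int : Integrable fun x => κ (y - x) • v x :=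
    (hc.convolutionExists_left (ContinuousLinearMap.lsmul ℝ ℝ) hκ hv y).integrable_swap
  simpa only [inner_smul_right, real_inner_comm] using h_int.const_inner (𝕜 := ℝ) a

theorem integral_inner_kernel_smul [CompleteSpace F] (hκ : Continuous κ) (hc : HasCompactSupport κ)
    (hv : LocallyIntegrable v) (a : F) (y : V) :
    ∫ x, inner ℝ (v x) (κ (y - x) • a) = inner ℝ a ((κ ⋆ v) y) := by
  have h_int : Integrable fun x => κ (y - x) • v x :=
    (hc.convolutionExists_left (ContinuousLinearMap.lsmul ℝ ℝ) hκ hv y).integrable_swap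
  rw [convolution_lsmul_swap, ← integral_inner h_int]
  simp only [inner_smul_right, real_inner_comm]

theorem MemLinftyLp.mollifiedTransport (hκ : ContDiff ℝ ∞ κ) (hc : HasCompactSupport κ)
    (hu : MemLinftyLp (Ico 0 T) 2 u) :
    MemLinftyLp (Ico 0 T) 2 fun t => mollifiedTransport e A κ (u t) :=
  .sum (by norm_num) fun k => (hu.convolution (contDiff_fderiv_apply hκ (e k)).continuous
    (memLp_fderiv_apply hκ hc (e k) 1)).comp_clm (A k)

theorem integrable_mollifiedTransport_apply (hκ : ContDiff ℝ ∞ κ) (hc : HasCompactSupport κ)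
    (hu : MemLinftyLp (Ico 0 T) 2 u) (y : V) :
    IntegrableOn (fun t => RVM.mollifiedTransport e A κ (u t) y) (Ico 0 T) :=
  integrable_finsetSum _ fun k _ => (A k).integrable_comp
    (hu.integrable_convolution_apply (contDiff_fderiv_apply hκ (e k)).continuous
      (memLp_fderiv_apply hκ hc (e k) 2) y)

theorem integrable_inner_transport_kernel (hκ : ContDiff ℝ ∞ κ) (hc : HasCompactSupport κ)
    (hv : LocallyIntegrable v) (a : F) (y : V) :
    Integrable fun x =>
      inner ℝ (v x) (∑ k, A k (fderiv ℝ (fun x => κ (y - x) • a) x (e k))) := by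
  simp only [fderiv_comp_sub_left_smul hκ, neg_smul, map_neg, map_smul, Finset.sum_neg_distrib,
    inner_neg_right, inner_sum]
  exact (integrable_finsetSum _ fun k _ => integrable_inner_kernel_smul
    (contDiff_fderiv_apply hκ (e k)).continuous (hc.fderiv_apply ℝ (e k)) hv _ y).neg

theorem integral_inner_mollifiedTransport (hκ : ContDiff ℝ ∞ κ) (hc : HasCompactSupport κ)
    (hA : ∀ k, (A k : F →ₗ[ℝ] F).IsSymmetric) (hv : MemLp v 2) :
    ∫ y, inner ℝ ((κ ⋆ v) y) (mollifiedTransport e A κ v y) = 0 := by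
  have hv_deriv : ∀ k, MemLp ((fun x => fderiv ℝ κ x (e k)) ⋆ v) 2 := fun k =>
    memLp_two_convolution (contDiff_fderiv_apply hκ _) (hc.fderiv_apply ℝ _) hv
  have hv_conv := memLp_two_convolution hκ hc hv
  simp only [mollifiedTransport, inner_sum]
  have h_int : ∀ k, Integrable fun y =>
      inner ℝ ((κ ⋆ v) y) (A k (((fun x => fderiv ℝ κ x (e k)) ⋆ v) y)) := fun k =>
    integrable_inner_of_memLp_two hv_conv ((A k).comp_memLp' (hv_deriv k))
  rw [integral_finsetSum _ fun k _ => h_int k]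
  exact Finset.sum_eq_zero fun k _ => integral_inner_apply_lineDeriv_eq_zero (hA k) hv_conv
    (hv_deriv k) fun x => hasLineDerivAt_convolution hκ hc (hv.locallyIntegrable (by norm_num)) x _

theorem inner_mollifiedTransport [CompleteSpace F] (hκ : ContDiff ℝ ∞ κ)
    (hc : HasCompactSupport κ) (hA : ∀ k, (A k : F →ₗ[ℝ] F).IsSymmetric)
    (hv : LocallyIntegrable v) (a : F) (y : V) :
    inner ℝ a (mollifiedTransport e A κ v y)
      = -∫ x, inner ℝ (v x) (∑ k, A k (fderiv ℝ (fun x => κ (y - x) • a) x (e k))) := by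
  have hd := fun k => (contDiff_fderiv_apply hκ (e k)).continuous
  have hdc := fun k => hc.fderiv_apply ℝ (e k)
  simp only [fderiv_comp_sub_left_smul hκ, neg_smul, map_neg, map_smul, Finset.sum_neg_distrib,
    inner_neg_right, integral_neg, neg_neg, inner_sum, mollifiedTransport]
  rw [integral_finsetSum _ fun k _ => integrable_inner_kernel_smul (hd k) (hdc k) hv _ y]
  refine Finset.sum_congr rfl fun k _ => ?_
  rw [integral_inner_kernel_smul (hd k) (hdc k) hv]
  exact (hA k _ _).symm

theorem mul_norm_sq_add_mul_two_mul_inner_sub (a b : ℝ) (x y z : F) :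
    a * ‖x‖ ^ 2 + b * (2 * inner ℝ x (y - z))
      = inner ℝ x (a • x) + 2 * inner ℝ x (b • y) - 2 * inner ℝ x (b • z) := by
  rw [inner_sub_right, inner_smul_right, inner_smul_right, inner_smul_right,
    real_inner_self_eq_norm_sq]
  ring

variable [FiniteDimensional ℝ F]

theorem WeakSystem.inner_convolution
    (hκ : ContDiff ℝ ∞ κ) (hc : HasCompactSupport κ)
    (hA : ∀ k, (A k : F →ₗ[ℝ] F).IsSymmetric) (hu : MemLinftyLp (Ico 0 T) 2 u)
    (hJ : MemLinftyLp (Ico 0 T) 1 J) (hu₀ : MemLp u₀ 2) (H : WeakSystem T e A u J u₀) (y : V)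
    (a : F) :
    WeakODE T (fun t => inner ℝ a ((κ ⋆ u t) y))
      (fun t => inner ℝ a ((κ ⋆ J t) y - mollifiedTransport e A κ (u t) y))
      (inner ℝ a ((κ ⋆ u₀) y)) := by
  have h := H (fun x => κ (y - x) • a)
    ((hκ.comp (contDiff_const.sub contDiff_id)).smul contDiff_const)
    (hc.comp_homeomorph (Homeomorph.subLeft y)).smul_right
  rw [integral_inner_kernel_smul hκ.continuous hc (hu₀.locallyIntegrable (by norm_num))] at h
  refine h.congr_ae ?_ ?_
  · filter_upwards [hu.ae_memLp] with t hut
    exact integral_inner_kernel_smul hκ.continuous hc (hut.locallyIntegrable (by norm_num)) a y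
  · filter_upwards [hu.ae_memLp, hJ.ae_memLp] with t hut hJt
    have hut_loc := hut.locallyIntegrable (by norm_num)
    have hJt_loc := hJt.locallyIntegrable (by norm_num)
    rw [integral_add (integrable_inner_transport_kernel hκ hc hut_loc a y)
      (integrable_inner_kernel_smul hκ.continuous hc hJt_loc a y),
      integral_inner_kernel_smul hκ.continuous hc hJt_loc, inner_sub_right,
      inner_mollifiedTransport hκ hc hA hut_loc]
    ring

theorem WeakSystem.norm_sq_convolution
    (hκ : ContDiff ℝ ∞ κ) (hc : HasCompactSupport κ)
    (hA : ∀ k, (A k : F →ₗ[ℝ] F).IsSymmetric) (hu : MemLinftyLp (Ico 0 T) 2 u)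
    (hJ : MemLinftyLp (Ico 0 T) 1 J) (hu₀ : MemLp u₀ 2) (H : WeakSystem T e A u J u₀)
    (hT : 0 < T) (y : V) :
    WeakODE T (fun t => ‖(κ ⋆ u t) y‖ ^ 2)
      (fun t => 2 * inner ℝ ((κ ⋆ u t) y) ((κ ⋆ J t) y - mollifiedTransport e A κ (u t) y))
      (‖(κ ⋆ u₀) y‖ ^ 2) :=
  .norm_sq hT
    (hu.integrable_convolution_apply hκ.continuous
      (hκ.continuous.memLp_of_hasCompactSupport (p := 2) hc) y)
    ((hJ.integrable_convolution_apply hκ.continuous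
      (hκ.continuous.memLp_of_hasCompactSupport (p := ⊤) hc) y).sub
      (integrable_mollifiedTransport_apply hκ hc hu y))
    (H.inner_convolution hκ hc hA hu hJ hu₀ y)

theorem WeakSystem.integral_norm_sq_convolution
    (hκ : ContDiff ℝ ∞ κ) (hc : HasCompactSupport κ)
    (hA : ∀ k, (A k : F →ₗ[ℝ] F).IsSymmetric) (hu : MemLinftyLp (Ico 0 T) 2 u)
    (hJ : MemLinftyLp (Ico 0 T) 1 J) (hu₀ : MemLp u₀ 2) (H : WeakSystem T e A u J u₀)
    (hT : 0 < T) (hθ : IsTimeTest T θ)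
    (hθJ : MemLinftyLp (Ico 0 T) 2 fun t x => θ t • J t x) :
    ∫ t in Ico 0 T, (deriv θ t * (∫ y, ‖(κ ⋆ u t) y‖ ^ 2)
        + 2 * ∫ y, inner ℝ ((κ ⋆ u t) y) ((κ ⋆ fun x => θ t • J t x) y))
      = -(θ 0 * ∫ y, ‖(κ ⋆ u₀) y‖ ^ 2) := by
  have hκ₁ : MemLp κ 1 := hκ.continuous.memLp_of_hasCompactSupport hc
  have hu_conv := hu.convolution hκ.continuous hκ₁
  have hu_tr := hu.mollifiedTransport (e := e) (A := A) hκ hc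
  have h_sq := (hu_conv.inner_of_holderTriple (r := 1)
    (hu_conv.smul_of_hasCompactSupport hθ.continuous_deriv hθ.compact.deriv)).integrable_prod
  have h_src := (hu_conv.inner_of_holderTriple (r := 1)
    (hθJ.convolution hκ.continuous hκ₁)).integrable_prod
  have h_tr := (hu_conv.inner_of_holderTriple (r := 1)
    (hu_tr.smul_of_hasCompactSupport hθ.continuous hθ.compact)).integrable_prod
  have h_split : ∀ t y, deriv θ t * ‖(κ ⋆ u t) y‖ ^ 2 + θ t * (2 * inner ℝ ((κ ⋆ u t) y)
        ((κ ⋆ J t) y - mollifiedTransport e A κ (u t) y))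
      = inner ℝ ((κ ⋆ u t) y) (deriv θ t • (κ ⋆ u t) y)
        + 2 * inner ℝ ((κ ⋆ u t) y) ((κ ⋆ fun x => θ t • J t x) y)
        - 2 * inner ℝ ((κ ⋆ u t) y) (θ t • mollifiedTransport e A κ (u t) y) := fun t y => by
    have h_smul : (κ ⋆ fun x => θ t • J t x) = θ t • (κ ⋆ J t) := convolution_smul
    rw [h_smul, mul_norm_sq_add_mul_two_mul_inner_sub, Pi.smul_apply]
  have h_swap := integral_integral_swap
    (f := fun t y => inner ℝ ((κ ⋆ u t) y) (deriv θ t • (κ ⋆ u t) y)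
      + 2 * inner ℝ ((κ ⋆ u t) y) ((κ ⋆ fun x => θ t • J t x) y)
      - 2 * inner ℝ ((κ ⋆ u t) y) (θ t • mollifiedTransport e A κ (u t) y))
    ((h_sq.add (h_src.const_mul 2)).sub (h_tr.const_mul 2))
  have h_ode := fun y => H.norm_sq_convolution hκ hc hA hu hJ hu₀ hT y θ hθ
  simp only [h_split] at h_ode
  rw [← integral_const_mul, ← integral_neg, ← integral_congr_ae (ae_of_all _ h_ode)]
  refine Eq.trans (integral_congr_ae ?_) h_swap
  filter_upwards [h_sq.prod_right_ae, h_src.prod_right_ae, h_tr.prod_right_ae, hu.ae_memLp]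
    with t h_sq_t h_src_t h_tr_t hut
  simp only [Function.uncurry_apply_pair] at h_sq_t h_src_t h_tr_t
  refine Eq.trans ?_ (integral_sub (h_sq_t.add (h_src_t.const_mul 2)) (h_tr_t.const_mul 2)).symm
  rw [integral_add' h_sq_t (h_src_t.const_mul 2)]
  simp only [inner_smul_right, integral_const_mul, real_inner_self_eq_norm_sq,
    integral_inner_mollifiedTransport hκ hc hA hut, mul_zero, sub_zero]

theorem WeakSystem.integral_norm_sq (hA : ∀ k, (A k : F →ₗ[ℝ] F).IsSymmetric)
    (hu : MemLinftyLp (Ico 0 T) 2 u) (hJ : MemLinftyLp (Ico 0 T) 1 J)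
    (hu₀ : MemLp u₀ 2) (H : WeakSystem T e A u J u₀) (hT : 0 < T) (hθ : IsTimeTest T θ)
    (hθJ : MemLinftyLp (Ico 0 T) 2 fun t x => θ t • J t x) :
    ∫ t in Ico 0 T, (deriv θ t * (∫ x, ‖u t x‖ ^ 2) + 2 * ∫ x, inner ℝ (u t x) (θ t • J t x))
      = -(θ 0 * ∫ x, ‖u₀ x‖ ^ 2) := by
  obtain ⟨C, hC⟩ := hu.exists_integral_norm_sq_le
  obtain ⟨D, hD⟩ := hθJ.exists_integral_norm_sq_le
  obtain ⟨M, hM⟩ := hθ.continuous_deriv.bounded_above_of_compact_support hθ.compact.deriv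
  have hu_conv := fun n => hu.convolution (contDiff_mollifier (V := V) n).continuous
    ((contDiff_mollifier n).continuous.memLp_of_hasCompactSupport (hasCompactSupport_mollifier n))
  have hθJ_conv := fun n => hθJ.convolution (contDiff_mollifier (V := V) n).continuous
    ((contDiff_mollifier n).continuous.memLp_of_hasCompactSupport (hasCompactSupport_mollifier n))
  refine tendsto_nhds_unique (tendsto_integral_of_dominated_convergence
    (F := fun n t => deriv θ t * (∫ y, ‖(mollifier n ⋆ u t) y‖ ^ 2)
      + 2 * ∫ y, inner ℝ ((mollifier n ⋆ u t) y) ((mollifier n ⋆ fun x => θ t • J t x) y))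
    (fun _ => M * C + 2 * (C + D)) (fun n => ?_) (integrable_const _) (fun n => ?_) ?_) ?_
  · have h_sq := ((hu_conv n).inner_of_holderTriple (r := 1) (hu_conv n)).integrable_prod
    have h_src := ((hu_conv n).inner_of_holderTriple (r := 1) (hθJ_conv n)).integrable_prod
    simp only [real_inner_self_eq_norm_sq] at h_sq
    exact (hθ.continuous_deriv.aestronglyMeasurable.mul h_sq.integral_prod_left.1).add
      (h_src.integral_prod_left.1.const_mul 2)
  · filter_upwards [hC, hD, hu.ae_memLp, hθJ.ae_memLp] with t hCt hDt hut hJt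
    exact norm_mul_integral_norm_sq_add_inner_mollifier_le hut hJt (hM t) hCt hDt n
  · filter_upwards [hu.ae_memLp, hθJ.ae_memLp] with t hut hJt
    exact ((tendsto_integral_norm_sq_mollifier_convolution hut).const_mul _).add
      ((tendsto_integral_inner_mollifier_convolution hut hJt).const_mul 2)
  · simp only [fun n => H.integral_norm_sq_convolution (contDiff_mollifier n)
      (hasCompactSupport_mollifier n) hA hu hJ hu₀ hT hθ hθJ]
    exact ((tendsto_integral_norm_sq_mollifier_convolution hu₀).const_mul _).neg

end WeakSystem

namespace MemLinftyLp

variable {X F : Type*} [MeasureSpace X] [NormedAddCommGroup F] {I : Set ℝ} {q : ℝ≥0∞}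
  {u w : ℝ → X → F}

theorem const [SFinite (volume : Measure X)] {v : X → F} (hv : MemLp v q) :
    MemLinftyLp I q fun _ => v :=
  ⟨hv.1.comp_snd, (eLpNorm v q volume).toNNReal,
    ae_of_all _ fun _ => (ENNReal.coe_toNNReal hv.2.ne).ge⟩

theorem add [SFinite (volume : Measure X)] (hq : 1 ≤ q) (hu : MemLinftyLp I q u)
    (hw : MemLinftyLp I q w) : MemLinftyLp I q fun t x => u t x + w t x := by
  have h_sum := MemLinftyLp.sum (u := ![u, w]) hq (Fin.forall_fin_two.2 ⟨hu, hw⟩)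
  simpa only [Fin.sum_univ_two, Matrix.cons_val] using h_sum

theorem prodLp {G : Type*} [NormedAddCommGroup G] [NormedSpace ℝ F] [NormedSpace ℝ G]
    [SFinite (volume : Measure X)] {w : ℝ → X → G} (hq : 1 ≤ q) (hu : MemLinftyLp I q u)
    (hw : MemLinftyLp I q w) : MemLinftyLp I q fun t x => WithLp.toLp 2 (u t x, w t x) := by
  let L := ((WithLp.prodContinuousLinearEquiv 2 ℝ F G).symm : F × G →L[ℝ] WithLp 2 (F × G))
  have h_add := (hu.comp_clm (L ∘L .inl ℝ F G)).add hq (hw.comp_clm (L ∘L .inr ℝ F G))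
  have h_split : ∀ a b, WithLp.toLp 2 (a, b) = (L ∘L .inl ℝ F G) a + (L ∘L .inr ℝ F G) b :=
    fun a b => by simp [L, ← WithLp.toLp_add]
  simpa only [h_split] using h_add

end MemLinftyLp

section ProductTests

theorem tsupport_smul_subset_prod {X F : Type*} [TopologicalSpace X] [NormedAddCommGroup F]
    [NormedSpace ℝ F] (θ : ℝ → ℝ) (Ψ : X → F) :
    tsupport (fun z : ℝ × X => θ z.1 • Ψ z.2) ⊆ tsupport θ ×ˢ tsupport Ψ := by
  refine closure_minimal (fun z hz => ?_) ((isClosed_tsupport _).prod (isClosed_tsupport _))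
  rw [Function.mem_support, smul_ne_zero_iff] at hz
  exact ⟨subset_tsupport _ hz.1, subset_tsupport _ hz.2⟩

variable {X F : Type*} [NormedAddCommGroup X] [NormedSpace ℝ X] [NormedAddCommGroup F]
  [NormedSpace ℝ F] {T : ℝ} {θ : ℝ → ℝ} {Ψ : X → F}

theorem IsTimeTest.isTest_smul (hθ : IsTimeTest T θ) (hΨ : ContDiff ℝ ∞ Ψ)
    (hc : HasCompactSupport Ψ) : IsTest T (fun z : ℝ × X => θ z.1 • Ψ z.2) where
  smooth := (hθ.smooth.comp contDiff_fst).smul (hΨ.comp contDiff_snd)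
  compact := (hθ.compact.isCompact.prod hc.isCompact).of_isClosed_subset (isClosed_tsupport _)
    (tsupport_smul_subset_prod θ Ψ)
  supp _ hz := hθ.supp (tsupport_smul_subset_prod θ Ψ hz).1

theorem fderiv_smul_prod {t : ℝ} {x : X} (hθ : DifferentiableAt ℝ θ t)
    (hΨ : DifferentiableAt ℝ Ψ x) (s : ℝ) (v : X) :
    fderiv ℝ (fun z : ℝ × X => θ z.1 • Ψ z.2) (t, x) (s, v)
      = (s * deriv θ t) • Ψ x + θ t • fderiv ℝ Ψ x v := by
  have h_time : HasFDerivAt (fun z : ℝ × X => θ z.1) _ (t, x) :=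
    HasFDerivAt.comp (t, x) hθ.hasFDerivAt hasFDerivAt_fst
  have h_space : HasFDerivAt (fun z : ℝ × X => Ψ z.2) _ (t, x) :=
    HasFDerivAt.comp (t, x) hΨ.hasFDerivAt hasFDerivAt_snd
  have h_eq : fderiv ℝ (fun z : ℝ × X => θ z.1 • Ψ z.2) (t, x) = _ := (h_time.smul h_space).fderiv
  rw [h_eq]
  simp [add_comm, fderiv_eq_smul_deriv]

end ProductTests

theorem WeakODE.of_integral_integral {X : Type*} [MeasurableSpace X] {μ : Measure X} {T w₀ : ℝ}
    {w G : ℝ → X → ℝ} (hw : ∀ᵐ t ∂(volume.restrict (Ico 0 T)), Integrable (w t) μ)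
    (hG : ∀ᵐ t ∂(volume.restrict (Ico 0 T)), Integrable (G t) μ)
    (H : ∀ θ, IsTimeTest T θ →
      ∫ t in Ico 0 T, ∫ x, (deriv θ t * w t x + θ t * G t x) ∂μ = -(θ 0 * w₀)) :
    WeakODE T (fun t => ∫ x, w t x ∂μ) (fun t => ∫ x, G t x ∂μ) w₀ := fun θ hθ => by
  rw [← H θ hθ]
  refine integral_congr_ae ?_
  filter_upwards [hw, hG] with t hwt hGt
  rw [integral_add (hwt.const_mul _) (hGt.const_mul _), integral_const_mul, integral_const_mul]

section Curl

/-- The cross product as a bounded bilinear map. -/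
def crossL : R3 →L[ℝ] R3 →L[ℝ] R3 :=
  (((crossProduct (R := ℝ)).compl₁₂ (WithLp.linearEquiv 2 ℝ (Fin 3 → ℝ)).toLinearMap
    (WithLp.linearEquiv 2 ℝ (Fin 3 → ℝ)).toLinearMap).compr₂
    (WithLp.linearEquiv 2 ℝ (Fin 3 → ℝ)).symm.toLinearMap).toContinuousBilinearMap

theorem crossL_apply (a b : R3) : crossL a b = cross a b := rfl

theorem inner_cross_left (a b c : R3) : inner ℝ (cross a b) c = -inner ℝ b (cross a c) := by
  simp only [cross, PiLp.inner_apply, Fin.sum_univ_three, crossProduct, LinearMap.mk₂_apply,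
    Matrix.cons_val, RCLike.inner_apply, conj_trivial]
  ring

theorem inner_self_cross (a b : R3) : inner ℝ a (cross a b) = 0 := by
  simp only [cross, PiLp.inner_apply, Fin.sum_univ_three, crossProduct, LinearMap.mk₂_apply,
    Matrix.cons_val, RCLike.inner_apply, conj_trivial]
  ring

theorem curl_eq_sum_cross (g : R3 → R3) (x : R3) :
    curl g x = ∑ k, cross (EuclideanSpace.single k 1)
      (fderiv ℝ g x (EuclideanSpace.single k 1)) := by
  ext i
  fin_cases i <;>
    simp [curl, partialDeriv, cross, Fin.sum_univ_three, crossProduct] <;> ring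

theorem continuous_curl {Ψ : R3 → R3} (hΨ : ContDiff ℝ ∞ Ψ) : Continuous (curl Ψ) := by
  simp only [funext (curl_eq_sum_cross Ψ), ← crossL_apply]
  exact continuous_finsetSum _ fun k _ =>
    (crossL _).continuous.comp (contDiff_fderiv_apply hΨ _).continuous

theorem hasCompactSupport_curl {Ψ : R3 → R3} (hc : HasCompactSupport Ψ) :
    HasCompactSupport (curl Ψ) := by
  refine (hc.fderiv ℝ).mono fun x hx h_zero => hx ?_
  simp only [curl_eq_sum_cross, h_zero, zero_apply, ← crossL_apply, map_zero,
    Finset.sum_const_zero]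

theorem curl_const_smul {Ψ : R3 → R3} {x : R3} (hΨ : DifferentiableAt ℝ Ψ x) (c : ℝ) :
    curl (fun y => c • Ψ y) x = c • curl Ψ x := by
  simp only [curl_eq_sum_cross, fderiv_fun_const_smul hΨ, smul_apply,
    ← crossL_apply, map_smul, Finset.smul_sum]

end Curl

section Current

variable {ν : Measure ℝ} {I : Set ℝ} {f : ℝ → R3 × R3 → ℝ}

theorem kin_pos (p : R3) : 0 < kin p := Real.sqrt_pos.2 (by positivity)

theorem norm_le_kin (p : R3) : ‖p‖ ≤ kin p :=
  Real.le_sqrt_of_sq_le (by linarith)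

theorem contDiff_kin : ContDiff ℝ ∞ kin :=
  ContDiff.sqrt (contDiff_const.add (contDiff_norm_sq ℝ)) fun p => by positivity

theorem norm_velocity_le_one (p : R3) : ‖velocity p‖ ≤ 1 := by
  rw [velocity, norm_smul, norm_inv, Real.norm_of_nonneg (kin_pos p).le,
    inv_mul_le_one₀ (kin_pos p)]
  exact norm_le_kin p

theorem continuous_velocity : Continuous velocity :=
  (contDiff_kin.continuous.inv₀ fun p => (kin_pos p).ne').smul continuous_id

theorem aestronglyMeasurable_prodAssoc
    (hf : AEStronglyMeasurable (Function.uncurry f) (ν.prod volume)) :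
    AEStronglyMeasurable (fun q : (ℝ × R3) × R3 => f q.1.1 (q.1.2, q.2))
      ((ν.prod volume).prod volume) := by
  rw [Measure.volume_eq_prod] at hf
  exact hf.comp_measurePreserving (measurePreserving_prodAssoc ν volume volume)

theorem aestronglyMeasurable_currentDensity
    (hf : AEStronglyMeasurable (Function.uncurry f) (ν.prod volume)) :
    AEStronglyMeasurable (Function.uncurry (currentDensity f)) (ν.prod volume) :=
  AEStronglyMeasurable.integral_prod_right'
    (f := fun q : (ℝ × R3) × R3 => f q.1.1 (q.1.2, q.2) • velocity q.2)
    ((aestronglyMeasurable_prodAssoc hf).smul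
      (continuous_velocity.comp continuous_snd).aestronglyMeasurable)

/-- The density `∫ |f| dp` with values in `[0, ∞]`. -/
def absDensity (f : ℝ → R3 × R3 → ℝ) (t : ℝ) (x : R3) : ℝ≥0∞ := ∫⁻ p, ‖f t (x, p)‖ₑ

theorem aemeasurable_absDensity
    (hf : AEStronglyMeasurable (Function.uncurry f) (ν.prod volume)) :
    AEMeasurable (Function.uncurry (absDensity f)) (ν.prod volume) :=
  (aestronglyMeasurable_prodAssoc hf).enorm.lintegral_prod_right'

theorem enorm_currentDensity_le_absDensity (f : ℝ → R3 × R3 → ℝ) (t : ℝ) (x : R3) :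
    ‖currentDensity f t x‖ₑ ≤ absDensity f t x := by
  refine (enorm_integral_le_lintegral_enorm _).trans (lintegral_mono fun p => ?_)
  rw [enorm_smul]
  refine mul_le_of_le_one_right zero_le ?_
  rw [← ofReal_norm]
  exact ENNReal.ofReal_le_one.2 (norm_velocity_le_one p)

theorem MemLinftyLp.currentDensity_of_absDensity {q : ℝ≥0∞}
    (hf : AEStronglyMeasurable (Function.uncurry f) ((volume.restrict I).prod volume))
    (hρ : MemLinftyLp I q (absDensity f)) : MemLinftyLp I q (currentDensity f) := by
  obtain ⟨C, hC⟩ := hρ.2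
  refine ⟨aestronglyMeasurable_currentDensity hf, C, ?_⟩
  filter_upwards [hC] with t hCt
  exact (eLpNorm_mono_enorm fun x => by
    simpa using enorm_currentDensity_le_absDensity f t x).trans hCt

theorem MemLinftyLp.absDensity (hf : MemLinftyLp I 1 f) : MemLinftyLp I 1 (absDensity f) := by
  obtain ⟨C, hC⟩ := hf.2
  refine ⟨(aemeasurable_absDensity hf.1).aestronglyMeasurable, C, ?_⟩
  filter_upwards [hC, hf.1.prodMk_left] with t hCt h_meas
  refine le_of_eq_of_le ?_ hCt
  rw [Measure.volume_eq_prod] at h_meas ⊢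
  simp only [eLpNorm_one_eq_lintegral_enorm, enorm_eq_self]
  exact (lintegral_prod _ h_meas.enorm).symm

theorem MemLinftyLp.currentDensity (hf : MemLinftyLp I 1 f) :
    MemLinftyLp I 1 (currentDensity f) :=
  currentDensity_of_absDensity hf.1 hf.absDensity

theorem currentDensity_mul (θ : ℝ → ℝ) (f : ℝ → R3 × R3 → ℝ) (t : ℝ) (x : R3) :
    currentDensity (fun t z => θ t * f t z) t x = θ t • currentDensity f t x := by
  simp only [currentDensity, mul_smul, integral_smul]

end Current

theorem MemLinftyLp.inner_const_of_hasCompactSupport {X F : Type*} [TopologicalSpace X]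
    [MeasureSpace X] [OpensMeasurableSpace X] [SFinite (volume : Measure X)]
    [IsFiniteMeasureOnCompacts (volume : Measure X)] [NormedAddCommGroup F]
    [InnerProductSpace ℝ F] [SecondCountableTopologyEither X F] {I : Set ℝ} {p : ℝ≥0∞}
    {u : ℝ → X → F} {Ψ : X → F} (q : ℝ≥0∞) [ENNReal.HolderTriple p q 1]
    (hu : MemLinftyLp I p u) (hΨ : Continuous Ψ) (hc : HasCompactSupport Ψ) :
    MemLinftyLp I 1 fun t x => inner ℝ (u t x) (Ψ x) :=
  hu.inner_of_holderTriple (.const (hΨ.memLp_of_hasCompactSupport (p := q) hc))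

section Maxwell

/-- The space of pairs `(E, B)` of field vectors, with the Euclidean norm `|E|² + |B|²`. -/
abbrev FieldPair := WithLp 2 (R3 × R3)

/-- The electromagnetic field as a single function with values in `FieldPair`. -/
def emField (e b : R3 → R3) (x : R3) : FieldPair := WithLp.toLp 2 (e x, b x)

/-- The matrices of Maxwell's equations as a first order system: `∑ₖ Aₖ ∂ₖ (E, B)` is
`(-∇ × B, ∇ × E)`. -/
def maxwellMatrix (k : Fin 3) : FieldPair →L[ℝ] FieldPair :=
  ((WithLp.prodContinuousLinearEquiv 2 ℝ R3 R3).symm : R3 × R3 →L[ℝ] FieldPair) ∘L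
    (-(crossL (EuclideanSpace.single k 1) ∘L WithLp.sndL 2 ℝ R3 R3)).prod
      (crossL (EuclideanSpace.single k 1) ∘L WithLp.fstL 2 ℝ R3 R3)

/-- The source term `(-4πj, 0)` of Maxwell's equations. -/
def maxwellSource (j : R3 → R3) : R3 → FieldPair := emField (fun x => -(4 * Real.pi) • j x) 0

variable {T : ℝ} {f₀ : R3 × R3 → ℝ} {E₀ B₀ e b : R3 → R3} {f : ℝ → R3 × R3 → ℝ}
  {E B : ℝ → R3 → R3} {Ψ : R3 → R3} {θ : ℝ → ℝ} {I : Set ℝ} {q : ℝ≥0∞}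

theorem norm_emField_sq (e b : R3 → R3) (x : R3) : ‖emField e b x‖ ^ 2 = ‖e x‖ ^ 2 + ‖b x‖ ^ 2 :=
  WithLp.prod_norm_sq_eq_of_L2 _

theorem inner_emField (e b : R3 → R3) (x : R3) (w : FieldPair) :
    inner ℝ (emField e b x) w = inner ℝ (e x) w.fst + inner ℝ (b x) w.snd :=
  WithLp.prod_inner_apply _ _

theorem memLp_emField (he : MemLp e 2) (hb : MemLp b 2) : MemLp (emField e b) 2 :=
  .of_fst_of_snd_prodLp ⟨he, hb⟩

theorem maxwellMatrix_apply (k : Fin 3) (w : FieldPair) :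
    maxwellMatrix k w = WithLp.toLp 2
      (-cross (EuclideanSpace.single k 1) w.snd, cross (EuclideanSpace.single k 1) w.fst) := rfl

theorem isSymmetric_maxwellMatrix (k : Fin 3) :
    (maxwellMatrix k : FieldPair →ₗ[ℝ] FieldPair).IsSymmetric := fun x y => by
  simp [maxwellMatrix_apply, WithLp.prod_inner_apply, inner_cross_left, add_comm]

theorem sum_maxwellMatrix_fderiv {ψ : R3 → FieldPair} (hψ : Differentiable ℝ ψ) (x : R3) :
    ∑ k, maxwellMatrix k (fderiv ℝ ψ x (EuclideanSpace.single k 1))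
      = WithLp.toLp 2 (-curl (fun y => (ψ y).snd) x, curl (fun y => (ψ y).fst) x) := by
  have h_fst : fderiv ℝ (fun y => (ψ y).fst) x = WithLp.fstL 2 ℝ R3 R3 ∘L fderiv ℝ ψ x :=
    ((WithLp.fstL 2 ℝ R3 R3).hasFDerivAt.comp x (hψ x).hasFDerivAt).fderiv
  have h_snd : fderiv ℝ (fun y => (ψ y).snd) x = WithLp.sndL 2 ℝ R3 R3 ∘L fderiv ℝ ψ x :=
    ((WithLp.sndL 2 ℝ R3 R3).hasFDerivAt.comp x (hψ x).hasFDerivAt).fderiv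
  simp only [curl_eq_sum_cross, h_fst, h_snd, maxwellMatrix_apply, Fin.sum_univ_three,
    ← WithLp.toLp_add, Prod.mk_add_mk, neg_add]
  rfl

namespace IsWeakSolution

theorem ampere_weakODE (hsol : IsWeakSolution T f₀ E₀ B₀ f E B) (hΨ : ContDiff ℝ ∞ Ψ)
    (hc : HasCompactSupport Ψ) :
    WeakODE T (fun t => ∫ x, inner ℝ (E t x) (Ψ x))
      (fun t => ∫ x, (inner ℝ (B t x) (curl Ψ x)
        + -(4 * Real.pi) * inner ℝ (currentDensity f t x) (Ψ x)))
      (∫ x, inner ℝ (E₀ x) (Ψ x)) := by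
  have hE := hsol.E_L2.inner_const_of_hasCompactSupport 2 hΨ.continuous hc
  have hB := hsol.B_L2.inner_const_of_hasCompactSupport 2 (continuous_curl hΨ)
    (hasCompactSupport_curl hc)
  have hj := hsol.f_L1.currentDensity.inner_const_of_hasCompactSupport ⊤ hΨ.continuous hc
  refine .of_integral_integral hE.integrable_prod.prod_right_ae
    (hB.integrable_prod.add (hj.integrable_prod.const_mul _)).prod_right_ae fun θ hθ => ?_
  have h_test := hsol.ampere _ (hθ.isTest_smul hΨ hc)
  simp only [inner_smul_right, integral_const_mul] at h_test
  rw [← h_test]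
  congr with t
  congr with x
  rw [fderiv_smul_prod (hθ.smooth.differentiable (by simp) t) (hΨ.differentiable (by simp) x),
    curl_const_smul (hΨ.differentiable (by simp) x)]
  simp only [map_zero, smul_zero, add_zero, one_mul, inner_smul_right]
  ring

theorem faraday_weakODE (hsol : IsWeakSolution T f₀ E₀ B₀ f E B) (hΨ : ContDiff ℝ ∞ Ψ)
    (hc : HasCompactSupport Ψ) :
    WeakODE T (fun t => ∫ x, inner ℝ (B t x) (Ψ x)) (fun t => ∫ x, -inner ℝ (E t x) (curl Ψ x))
      (∫ x, inner ℝ (B₀ x) (Ψ x)) := by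
  have hB := hsol.B_L2.inner_const_of_hasCompactSupport 2 hΨ.continuous hc
  have hE := hsol.E_L2.inner_const_of_hasCompactSupport 2 (continuous_curl hΨ)
    (hasCompactSupport_curl hc)
  refine .of_integral_integral hB.integrable_prod.prod_right_ae
    hE.integrable_prod.neg.prod_right_ae fun θ hθ => ?_
  have h_test := hsol.faraday _ (hθ.isTest_smul hΨ hc)
  simp only [inner_smul_right, integral_const_mul] at h_test
  rw [← h_test]
  congr with t
  congr with x
  rw [fderiv_smul_prod (hθ.smooth.differentiable (by simp) t) (hΨ.differentiable (by simp) x),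
    curl_const_smul (hΨ.differentiable (by simp) x)]
  simp only [map_zero, smul_zero, add_zero, one_mul, inner_smul_right]
  ring

theorem emField_L2 (hsol : IsWeakSolution T f₀ E₀ B₀ f E B) :
    MemLinftyLp (Ico 0 T) 2 fun t => emField (E t) (B t) :=
  .prodLp one_le_two hsol.E_L2 hsol.B_L2

end IsWeakSolution

theorem inner_emField_maxwellSource (e b j : R3 → R3) (x : R3) :
    inner ℝ (emField e b x) (maxwellSource j x) = -(4 * Real.pi) * inner ℝ (e x) (j x) := by
  rw [inner_emField, maxwellSource, emField, WithLp.toLp_fst, WithLp.toLp_snd, Pi.zero_apply,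
    inner_zero_right, add_zero, real_inner_smul_right]

theorem smul_maxwellSource (c : ℝ) (j : R3 → R3) (x : R3) :
    c • maxwellSource j x = maxwellSource (fun x => c • j x) x := by
  simp [maxwellSource, emField, ← WithLp.toLp_smul, smul_comm c]

theorem memLinftyLp_maxwellSource {j : ℝ → R3 → R3} (hq : 1 ≤ q) (hj : MemLinftyLp I q j) :
    MemLinftyLp I q fun t => maxwellSource (j t) :=
  .prodLp hq (hj.comp_clm (-(4 * Real.pi) • .id ℝ R3)) (.const MemLp.zero)

theorem IsWeakSolution.weakSystem_maxwell (hE₀ : MemLp E₀ 2) (hB₀ : MemLp B₀ 2)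
    (hsol : IsWeakSolution T f₀ E₀ B₀ f E B) :
    WeakSystem T (fun k => EuclideanSpace.single k 1) maxwellMatrix
      (fun t => emField (E t) (B t)) (fun t => maxwellSource (currentDensity f t))
      (emField E₀ B₀) := by
  intro ψ hψ hc
  have hψ₁ : ContDiff ℝ ∞ fun x => (ψ x).fst := (WithLp.fstL 2 ℝ R3 R3).contDiff.comp hψ
  have hψ₂ : ContDiff ℝ ∞ fun x => (ψ x).snd := (WithLp.sndL 2 ℝ R3 R3).contDiff.comp hψ
  have hc₁ : HasCompactSupport fun x => (ψ x).fst := hc.comp_left (g := WithLp.fst) rfl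
  have hc₂ : HasCompactSupport fun x => (ψ x).snd := hc.comp_left (g := WithLp.snd) rfl
  have hE := (hsol.E_L2.inner_const_of_hasCompactSupport 2 hψ₁.continuous hc₁).integrable_prod
  have hB := (hsol.B_L2.inner_const_of_hasCompactSupport 2 hψ₂.continuous hc₂).integrable_prod
  have hj := (hsol.f_L1.currentDensity.inner_const_of_hasCompactSupport ⊤ hψ₁.continuous
    hc₁).integrable_prod
  have hE_curl := (hsol.E_L2.inner_const_of_hasCompactSupport 2 (continuous_curl hψ₂)
    (hasCompactSupport_curl hc₂)).integrable_prod.neg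
  have hB_curl := ((hsol.B_L2.inner_const_of_hasCompactSupport 2 (continuous_curl hψ₁)
    (hasCompactSupport_curl hc₁)).integrable_prod.add (hj.const_mul (-(4 * Real.pi))))
  have h_add := (hsol.ampere_weakODE hψ₁ hc₁).add hE.integral_prod_left
    hB_curl.integral_prod_left hB.integral_prod_left hE_curl.integral_prod_left
    (hsol.faraday_weakODE hψ₂ hc₂)
  rw [← integral_add (integrable_inner_of_memLp_two hE₀
    (hψ₁.continuous.memLp_of_hasCompactSupport hc₁)) (integrable_inner_of_memLp_two hB₀
    (hψ₂.continuous.memLp_of_hasCompactSupport hc₂))] at h_add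
  simp only [← inner_emField] at h_add
  refine h_add.congr_ae ?_ ?_
  · filter_upwards [hE.prod_right_ae, hB.prod_right_ae] with t hEt hBt
    simpa only [inner_emField, Function.uncurry_apply_pair] using (integral_add hEt hBt).symm
  · filter_upwards [hB_curl.prod_right_ae, hE_curl.prod_right_ae] with t hBt hEt
    refine (integral_add hBt hEt).symm.trans (integral_congr_ae (ae_of_all _ fun x => ?_))
    simp only [sum_maxwellMatrix_fderiv (hψ.differentiable (by simp)), maxwellSource,
      inner_emField, Pi.zero_apply, inner_zero_left, inner_neg_right, real_inner_smul_left,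
      Function.uncurry_apply_pair, Pi.add_apply, Pi.neg_apply, WithLp.toLp_fst, WithLp.toLp_snd]
    ring

theorem IsWeakSolution.field_energy (hT : 0 < T) (hE₀ : MemLp E₀ 2) (hB₀ : MemLp B₀ 2)
    (hsol : IsWeakSolution T f₀ E₀ B₀ f E B) (hθ : IsTimeTest T θ)
    (hθj : MemLinftyLp (Ico 0 T) 2 fun t x => θ t • currentDensity f t x) :
    ∫ t in Ico 0 T, (deriv θ t * (∫ x, (‖E t x‖ ^ 2 + ‖B t x‖ ^ 2))
        - 8 * Real.pi * ∫ x, inner ℝ (E t x) (θ t • currentDensity f t x))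
      = -(θ 0 * ∫ x, (‖E₀ x‖ ^ 2 + ‖B₀ x‖ ^ 2)) := by
  have hθJ : MemLinftyLp (Ico 0 T) 2 fun t x => θ t • maxwellSource (currentDensity f t) x := by
    simpa only [smul_maxwellSource] using memLinftyLp_maxwellSource one_le_two hθj
  have h_energy := (hsol.weakSystem_maxwell hE₀ hB₀).integral_norm_sq isSymmetric_maxwellMatrix
    hsol.emField_L2 (memLinftyLp_maxwellSource le_rfl hsol.f_L1.currentDensity)
    (memLp_emField hE₀ hB₀) hT hθ hθJ
  simp only [norm_emField_sq, smul_maxwellSource, inner_emField_maxwellSource,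
    integral_const_mul] at h_energy
  rw [← h_energy]
  congr with t
  ring

end Maxwell

section Density

theorem eLpNorm_two_lintegral_enorm_sq_le {X P : Type*} [MeasurableSpace X] [MeasurableSpace P]
    {μ : Measure X} {π : Measure P} [SFinite μ] [SFinite π] {g : X × P → ℝ} {M : ℝ≥0∞}
    (hg : AEStronglyMeasurable g (μ.prod π)) (hM : ∀ᵐ z ∂(μ.prod π), ‖g z‖ₑ ≤ M) :
    eLpNorm (fun x => ∫⁻ p, ‖g (x, p)‖ₑ ∂π) 2 μ ^ 2 ≤ M * π univ * eLpNorm g 1 (μ.prod π) := by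
  rw [eLpNorm_two_sq, eLpNorm_one_eq_lintegral_enorm, lintegral_prod _ hg.enorm,
    ← lintegral_const_mul'' _ hg.enorm.lintegral_prod_right']
  refine lintegral_mono_ae ?_
  filter_upwards [Measure.ae_ae_of_ae_prod hM] with x hx
  rw [enorm_eq_self, sq]
  gcongr
  exact (lintegral_mono_ae hx).trans_eq (lintegral_const M)

variable {I J : Set ℝ} {f : ℝ → R3 × R3 → ℝ} {q : ℝ≥0∞}

theorem MemLinftyLp.mono {X F : Type*} [MeasureSpace X] [SFinite (volume : Measure X)]
    [TopologicalSpace F] [ENorm F] {u : ℝ → X → F} (hIJ : I ⊆ J) (hu : MemLinftyLp J q u) :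
    MemLinftyLp I q u := by
  obtain ⟨h_meas, C, hC⟩ := hu
  exact ⟨h_meas.mono_measure (Measure.prod_mono (Measure.restrict_mono_set _ hIJ) le_rfl), C,
    ae_restrict_of_ae_restrict_of_subset hIJ hC⟩

theorem MemLinftyLp.indicator {X F : Type*} [MeasureSpace X] [NormedAddCommGroup F]
    {u : ℝ → X → F} {s : Set X} (hs : MeasurableSet s) (hu : MemLinftyLp I q u) :
    MemLinftyLp I q fun t => s.indicator (u t) := by
  obtain ⟨h_meas, C, hC⟩ := hu
  refine ⟨?_, C, hC.mono fun t hCt => (eLpNorm_indicator_le (u t)).trans hCt⟩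
  exact h_meas.indicator (measurable_snd hs)

theorem MemLinftyLp.absDensity_two_of_tail {K : Set R3} {m : ℝ → R3 → ℝ≥0∞}
    (hK : MeasurableSet K) (hK_fin : volume K ≠ ⊤) (hf : MemLinftyLp I 1 f)
    (hf_bdd : MemLinftyLp I ⊤ f) (hm : MemLinftyLp I 2 m)
    (hfm : ∀ᵐ t ∂(volume.restrict I), ∀ᵐ x, ∫⁻ p in Kᶜ, ‖f t (x, p)‖ₑ ≤ m t x) :
    MemLinftyLp I 2 (RVM.absDensity f) := by
  obtain ⟨C₁, hC₁⟩ := hf.2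
  obtain ⟨C, hC⟩ := hf_bdd.2
  obtain ⟨D, hD⟩ := hm.2
  have h_meas := aemeasurable_absDensity hf.1
  refine ⟨h_meas.aestronglyMeasurable, NNReal.sqrt (C * (volume K).toNNReal * C₁) + D, ?_⟩
  filter_upwards [hC₁, hC, hD, hfm, hf.ae_memLp] with t hC₁t hCt hDt hfmt hft
  have hK_le : (volume : Measure R3).prod (volume.restrict K) ≤ volume :=
    Measure.prod_mono le_rfl Measure.restrict_le_self
  have h_head : eLpNorm (fun x => ∫⁻ p in K, ‖f t (x, p)‖ₑ) 2 volume
      ≤ NNReal.sqrt (C * (volume K).toNNReal * C₁) := by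
    rw [← ENNReal.pow_le_pow_left_iff two_ne_zero, ← ENNReal.coe_pow, NNReal.sq_sqrt,
      ENNReal.coe_mul, ENNReal.coe_mul, ENNReal.coe_toNNReal hK_fin]
    refine (eLpNorm_two_lintegral_enorm_sq_le (M := C) (hft.1.mono_measure hK_le)
      (ae_mono hK_le ?_)).trans ?_
    · exact (ae_le_eLpNormEssSup (f := f t)).mono fun z hz => hz.trans (by simpa using hCt)
    · rw [Measure.restrict_apply_univ]
      gcongr
      exact (eLpNorm_mono_measure _ hK_le).trans hC₁t
  have h_tail : eLpNorm (fun x => ∫⁻ p in Kᶜ, ‖f t (x, p)‖ₑ) 2 volume ≤ D :=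
    (eLpNorm_mono_enorm_ae (by simpa only [enorm_eq_self] using hfmt)).trans hDt
  have h_split : RVM.absDensity f t
      = (fun x => ∫⁻ p in K, ‖f t (x, p)‖ₑ) + fun x => ∫⁻ p in Kᶜ, ‖f t (x, p)‖ₑ :=
    funext fun x => (lintegral_add_compl _ hK).symm
  have h_meas_t : ∀ s : Set R3,
      AEStronglyMeasurable (fun x => ∫⁻ p in s, ‖f t (x, p)‖ₑ) volume := fun s =>
    (hft.1.mono_measure (Measure.prod_mono le_rfl
      Measure.restrict_le_self)).enorm.lintegral_prod_right'.aestronglyMeasurable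
  rw [h_split, ENNReal.coe_add]
  exact (eLpNorm_add_le (h_meas_t K) (h_meas_t Kᶜ) one_le_two).trans (add_le_add h_head h_tail)

end Density

section MomentBound

variable {I S : Set ℝ} {f : ℝ → R3 × R3 → ℝ} {q : ℝ≥0∞} {θ : ℝ → ℝ} {l : ℝ}

theorem setLIntegral_compl_closedBall_le_moment (hl : 0 ≤ l) {t : ℝ} {x : R3}
    (hf : ∀ᵐ p, 0 ≤ f t (x, p)) :
    ∫⁻ p in (Metric.closedBall 0 1)ᶜ, ‖f t (x, p)‖ₑ ≤ moment l f t x := by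
  refine le_trans ?_ (setLIntegral_le_lintegral (Metric.closedBall 0 1)ᶜ _)
  refine setLIntegral_mono_ae' measurableSet_closedBall.compl ?_
  filter_upwards [hf] with p hp hpK
  have h_one_le : 1 ≤ ‖p‖ := by
    rw [mem_compl_iff, mem_closedBall_zero_iff, not_le] at hpK
    exact hpK.le
  rw [Real.enorm_of_nonneg hp]
  exact ENNReal.ofReal_le_ofReal (le_mul_of_one_le_left hp (Real.one_le_rpow h_one_le hl))

theorem MemLinftyLp.absDensity_of_moment (hl : 0 ≤ l) (hf : MemLinftyLp I 1 f)
    (hf_bdd : MemLinftyLp I ⊤ f) (hf_nonneg : ∀ᵐ t ∂(volume.restrict I), ∀ᵐ z, 0 ≤ f t z)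
    (hm : MemLinftyLp I 2 (moment l f)) : MemLinftyLp I 2 (RVM.absDensity f) := by
  refine absDensity_two_of_tail (K := Metric.closedBall 0 1) measurableSet_closedBall
    measure_closedBall_lt_top.ne hf hf_bdd hm ?_
  filter_upwards [hf_nonneg] with t ht
  filter_upwards [Measure.ae_ae_of_ae_prod ht] with x hx
  exact setLIntegral_compl_closedBall_le_moment hl hx

theorem MemLinftyLp.absDensity_indicator {K : Set R3} (hK : MeasurableSet K)
    (hK_fin : volume K ≠ ⊤) (hf : MemLinftyLp I 1 f) (hf_bdd : MemLinftyLp I ⊤ f) :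
    MemLinftyLp I 2 (RVM.absDensity fun t => (univ ×ˢ K).indicator (f t)) := by
  have h_univ_prod : MeasurableSet ((univ : Set R3) ×ˢ K) := MeasurableSet.univ.prod hK
  refine absDensity_two_of_tail (m := 0) hK hK_fin (hf.indicator h_univ_prod)
    (hf_bdd.indicator h_univ_prod) ⟨aestronglyMeasurable_zero, 0, by simp⟩
    (ae_of_all _ fun t => ae_of_all _ fun x => ?_)
  refine (setLIntegral_congr_fun (g := 0) hK.compl fun p hp => ?_).trans_le (by simp)
  simp [(mem_compl_iff K p).1 hp]

theorem absDensity_mul (θ : ℝ → ℝ) (f : ℝ → R3 × R3 → ℝ) (t : ℝ) :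
    absDensity (fun t z => θ t * f t z) t = fun x => ‖θ t‖ₑ * absDensity f t x := by
  funext x
  simp only [absDensity, enorm_mul, lintegral_const_mul' _ _ enorm_ne_top]

theorem MemLinftyLp.absDensity_mul_of_support (hθ : Continuous θ) (hc : HasCompactSupport θ)
    (hI : MeasurableSet I) (hS : MeasurableSet S) (hθS : ∀ t ∈ I, t ∉ S → θ t = 0)
    (hf : AEStronglyMeasurable (Function.uncurry f) ((volume.restrict I).prod volume))
    (hρ : MemLinftyLp S q (RVM.absDensity f)) :
    MemLinftyLp I q (RVM.absDensity fun t z => θ t * f t z) := by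
  obtain ⟨M, hM⟩ := hθ.bounded_above_of_compact_support hc
  obtain ⟨C, hC⟩ := hρ.2
  have h_meas := hθ.aestronglyMeasurable.comp_fst.mul hf
  refine ⟨(aemeasurable_absDensity (f := fun t z => θ t * f t z) h_meas).aestronglyMeasurable,
    M.toNNReal * C, ?_⟩
  filter_upwards [ae_restrict_of_ae ((ae_restrict_iff' hS).1 hC), ae_restrict_mem hI] with t hCt htI
  rw [absDensity_mul]
  by_cases htS : t ∈ S
  · have h_le : ‖θ t‖₊ ≤ M.toNNReal := NNReal.coe_le_coe.1 ((hM t).trans (Real.le_coe_toNNReal M))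
    refine (eLpNorm_le_nnreal_smul_eLpNorm_of_ae_le_mul' (g := RVM.absDensity f t)
      (c := M.toNNReal) (ae_of_all _ fun x => ?_) q).trans ?_
    · rw [enorm_eq_self, enorm_eq_self]
      gcongr
      exact ENNReal.coe_le_coe.2 h_le
    · rw [ENNReal.smul_def, smul_eq_mul, ENNReal.coe_mul]
      gcongr
      exact hCt htS
  · simp [hθS t htI htS]

end MomentBound

theorem lintegral_enorm_mul_enorm_le_eLpNorm_two {X ε ε' : Type*} [MeasurableSpace X]
    {μ : Measure X} [TopologicalSpace ε] [ContinuousENorm ε] [TopologicalSpace ε']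
    [ContinuousENorm ε'] {u : X → ε} {w : X → ε'}
    (hu : AEStronglyMeasurable u μ) (hw : AEStronglyMeasurable w μ) :
    ∫⁻ x, ‖u x‖ₑ * ‖w x‖ₑ ∂μ ≤ eLpNorm u 2 μ * eLpNorm w 2 μ := by
  simpa [eLpNorm_eq_lintegral_rpow_enorm_toReal] using
    ENNReal.lintegral_mul_le_Lp_mul_Lq μ Real.HolderConjugate.two_two hu.enorm hw.enorm

section Drift

variable {I : Set ℝ} {g : ℝ → R3 × R3 → ℝ} {E B : ℝ → R3 → R3}

theorem MemLinftyLp.smul_comp_position {F : Type*} [NormedAddCommGroup F] [NormedSpace ℝ F]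
    {U : ℝ → R3 → F}
    (hg : AEStronglyMeasurable (Function.uncurry g) ((volume.restrict I).prod volume))
    (hρ : MemLinftyLp I 2 (RVM.absDensity g)) (hU : MemLinftyLp I 2 U) :
    MemLinftyLp I 1 fun t z => g t z • U t z.1 := by
  obtain ⟨C, hC⟩ := hρ.2
  obtain ⟨D, hD⟩ := hU.2
  have h_meas : AEStronglyMeasurable (fun q : ℝ × (R3 × R3) => g q.1 q.2 • U q.1 q.2.1)
      ((volume.restrict I).prod volume) :=
    hg.smul ((hU.1.comp_fst (ν := volume)).comp_measurePreserving
      (measurePreserving_prodAssoc _ _ _).symm)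
  refine ⟨h_meas, C * D, ?_⟩
  filter_upwards [hC, hD, hρ.1.prodMk_left, hU.1.prodMk_left, h_meas.prodMk_left]
    with t hCt hDt hρt hUt h_meas_t
  calc eLpNorm (fun z => g t z • U t z.1) 1 volume
      = ∫⁻ x, ∫⁻ p, ‖g t (x, p) • U t x‖ₑ := by
        rw [eLpNorm_one_eq_lintegral_enorm, Measure.volume_eq_prod]
        exact lintegral_prod _ h_meas_t.enorm
    _ = ∫⁻ x, ‖RVM.absDensity g t x‖ₑ * ‖U t x‖ₑ := by
        simp only [enorm_smul, enorm_eq_self, RVM.absDensity,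
          lintegral_mul_const' _ _ enorm_ne_top]
    _ ≤ eLpNorm (RVM.absDensity g t) 2 volume * eLpNorm (U t) 2 volume :=
        lintegral_enorm_mul_enorm_le_eLpNorm_two hρt hUt
    _ ≤ ↑(C * D) := by
        rw [ENNReal.coe_mul]
        gcongr

/-- The vector field `(v, K)` on phase space that transports `f`. -/
def drift (E B : ℝ → R3 → R3) (t : ℝ) (z : R3 × R3) : R3 × R3 :=
  (velocity z.2, lorentz (E t z.1) (B t z.1) z.2)

theorem integrable_smul_drift [IsFiniteMeasure (volume.restrict I)] (hg : MemLinftyLp I 1 g)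
    (hρ : MemLinftyLp I 2 (absDensity g)) (hE : MemLinftyLp I 2 E) (hB : MemLinftyLp I 2 B) :
    Integrable (fun q : ℝ × (R3 × R3) => g q.1 q.2 • drift E B q.1 q.2)
      ((volume.restrict I).prod volume) := by
  have h_vel : AEStronglyMeasurable (fun q : ℝ × (R3 × R3) => velocity q.2.2)
      ((volume.restrict I).prod volume) :=
    (continuous_velocity.comp (continuous_snd.comp continuous_snd)).aestronglyMeasurable
  have h_vel_le : ∀ᵐ q : ℝ × (R3 × R3) ∂(volume.restrict I).prod volume, ‖velocity q.2.2‖ ≤ 1 :=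
    ae_of_all _ fun q => norm_velocity_le_one q.2.2
  have hgv : Integrable (fun q : ℝ × (R3 × R3) => g q.1 q.2 • velocity q.2.2)
      ((volume.restrict I).prod volume) :=
    hg.integrable_prod.smul_bdd 1 h_vel h_vel_le
  have hgE := (hρ.smul_comp_position hg.1 hE).integrable_prod
  have hgB := (hρ.smul_comp_position hg.1 hB).integrable_prod
  have hgvB := crossL.integrable_of_bilin_of_bdd_left 1 h_vel h_vel_le hgB
  refine (hgv.prodMk (hgE.add hgvB)).congr (ae_of_all _ fun q => ?_)
  simp [Function.uncurry_def, drift, lorentz, ← crossL_apply, smul_add]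

end Drift

section Vlasov

variable {T : ℝ} {f₀ : R3 × R3 → ℝ} {E₀ B₀ : R3 → R3} {f : ℝ → R3 × R3 → ℝ} {E B : ℝ → R3 → R3}
  {Φ : R3 × R3 → ℝ} {θ : ℝ → ℝ}

theorem integrable_fderiv_comp_snd {V : Type*} [NormedAddCommGroup V] [NormedSpace ℝ V]
    [MeasurableSpace V] [BorelSpace V] [SecondCountableTopology V] {μ : Measure (ℝ × V)}
    {Φ : V → ℝ} (hΦ : ContDiff ℝ ∞ Φ) (hc : HasCompactSupport Φ) {w : ℝ × V → V}
    (hw : Integrable w μ) : Integrable (fun q => fderiv ℝ Φ q.2 (w q)) μ := by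
  have h_cont : Continuous (fderiv ℝ Φ) := hΦ.continuous_fderiv (by simp)
  obtain ⟨C, hC⟩ := h_cont.bounded_above_of_compact_support (hc.fderiv ℝ)
  exact (ContinuousLinearMap.id ℝ (V →L[ℝ] ℝ)).integrable_of_bilin_of_bdd_left C
    (h_cont.comp continuous_snd).aestronglyMeasurable (ae_of_all _ fun q => hC q.2) hw

namespace IsWeakSolution

theorem integrable_mul (hsol : IsWeakSolution T f₀ E₀ B₀ f E B) (hΦ : Continuous Φ)
    (hc : HasCompactSupport Φ) :
    Integrable (fun q : ℝ × (R3 × R3) => f q.1 q.2 * Φ q.2)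
      ((volume.restrict (Ico 0 T)).prod volume) := by
  obtain ⟨C, hC⟩ := hΦ.bounded_above_of_compact_support hc
  exact hsol.f_L1.integrable_prod.mul_bdd (hΦ.comp continuous_snd).aestronglyMeasurable
    (ae_of_all _ fun q => hC q.2)

theorem integrable_mul_fderiv_drift (hsol : IsWeakSolution T f₀ E₀ B₀ f E B)
    (hΦ : ContDiff ℝ ∞ Φ) (hc : HasCompactSupport Φ) :
    Integrable (fun q : ℝ × (R3 × R3) => f q.1 q.2 * fderiv ℝ Φ q.2 (drift E B q.1 q.2))
      ((volume.restrict (Ico 0 T)).prod volume) := by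
  set K : Set R3 := Prod.snd '' tsupport Φ
  have hK : IsCompact K := hc.isCompact.image continuous_snd
  have h_univ_prod : MeasurableSet ((univ : Set R3) ×ˢ K) :=
    MeasurableSet.univ.prod hK.measurableSet
  have h_drift := integrable_smul_drift (hsol.f_L1.indicator h_univ_prod)
    (hsol.f_L1.absDensity_indicator hK.measurableSet hK.measure_lt_top.ne hsol.f_Linfty)
    hsol.E_L2 hsol.B_L2
  refine (integrable_fderiv_comp_snd hΦ hc h_drift).congr (ae_of_all _ fun q => ?_)
  by_cases hq : q.2 ∈ tsupport Φ
  · simp [indicator_of_mem (show q.2 ∈ univ ×ˢ K from ⟨trivial, mem_image_of_mem _ hq⟩)]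
  · simp [image_eq_zero_of_notMem_tsupport
      (Set.notMem_subset (tsupport_fderiv_subset ℝ (f := Φ)) hq)]

theorem integral_vlasov (hsol : IsWeakSolution T f₀ E₀ B₀ f E B) (hΦ : ContDiff ℝ ∞ Φ)
    (hc : HasCompactSupport Φ) (hθ : IsTimeTest T θ) :
    ∫ t in Ico 0 T, ∫ z, (deriv θ t * (f t z * Φ z)
        + θ t * (f t z * fderiv ℝ Φ z (drift E B t z)))
      = -(θ 0 * ∫ z, f₀ z * Φ z) := by
  have h_test := hsol.vlasov _ (hθ.isTest_smul hΦ hc)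
  simp only [smul_eq_mul, mul_left_comm _ (θ 0), integral_const_mul] at h_test
  rw [← h_test]
  congr with t
  congr with z
  have h_fderiv := fderiv_smul_prod (hθ.smooth.differentiable (by simp) t)
    (hΦ.differentiable (by simp) z) 1 (drift E B t z)
  simp only [smul_eq_mul, drift, one_mul] at h_fderiv ⊢
  rw [h_fderiv]
  ring

theorem vlasov_weakODE (hsol : IsWeakSolution T f₀ E₀ B₀ f E B) (hΦ : ContDiff ℝ ∞ Φ)
    (hc : HasCompactSupport Φ) :
    WeakODE T (fun t => ∫ z, f t z * Φ z)
      (fun t => ∫ z, f t z * fderiv ℝ Φ z (drift E B t z)) (∫ z, f₀ z * Φ z) :=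
  .of_integral_integral (hsol.integrable_mul hΦ.continuous hc).prod_right_ae
    (hsol.integrable_mul_fderiv_drift hΦ hc).prod_right_ae fun _ => hsol.integral_vlasov hΦ hc

end IsWeakSolution

end Vlasov

section Truncation

variable {V : Type*} [NormedAddCommGroup V] [NormedSpace ℝ V]

theorem exists_one_add_norm_mul_norm_fderiv_le {φ : V → ℝ} (hφ : ContDiff ℝ ∞ φ)
    (hc : HasCompactSupport φ) : ∃ C : ℝ, ∀ x, (1 + ‖x‖) * ‖fderiv ℝ φ x‖ ≤ C := by
  have h_cont : Continuous fun x => (1 + ‖x‖) * ‖fderiv ℝ φ x‖ :=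
    (continuous_const.add continuous_norm).mul (hφ.continuous_fderiv (by simp)).norm
  obtain ⟨C, hC⟩ := h_cont.bounded_above_of_compact_support
    ((hc.fderiv ℝ).mono fun x hx h_zero => hx (by simp [h_zero]))
  exact ⟨C, fun x => (le_abs_self _).trans (hC x)⟩

variable [FiniteDimensional ℝ V]

/-- A smooth function on `V` with values in `[0, 1]`, equal to one on the ball of radius `n + 1` and
vanishing outside the ball of twice this radius. -/
def cutoff (n : ℕ) (x : V) : ℝ :=
  (⟨1, 2, one_pos, one_lt_two⟩ : ContDiffBump (0 : V)) (((n : ℝ) + 1)⁻¹ • x)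

theorem contDiff_cutoff (n : ℕ) : ContDiff ℝ ∞ (cutoff n : V → ℝ) :=
  (ContDiffBump.contDiff _).comp (contDiff_const_smul _)

theorem hasCompactSupport_cutoff (n : ℕ) : HasCompactSupport (cutoff n : V → ℝ) :=
  (ContDiffBump.hasCompactSupport _).comp_smul (by positivity)

theorem norm_cutoff_le_one (n : ℕ) (x : V) : ‖cutoff n x‖ ≤ 1 := by
  rw [cutoff, Real.norm_of_nonneg (ContDiffBump.nonneg _)]
  exact ContDiffBump.le_one _

theorem cutoff_eq_one {n : ℕ} {x : V} (hx : ‖x‖ ≤ n + 1) : cutoff n x = 1 := by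
  refine ContDiffBump.one_of_mem_closedBall _ ?_
  rw [mem_closedBall_zero_iff, norm_smul, norm_inv, Real.norm_of_nonneg (by positivity)]
  exact inv_mul_le_one_of_le₀ hx (by positivity)

theorem eventually_cutoff_eventuallyEq_one (x : V) : ∀ᶠ n in atTop, cutoff n =ᶠ[𝓝 x] 1 := by
  filter_upwards [eventually_gt_atTop ⌈‖x‖⌉₊] with n hn
  filter_upwards [continuous_norm.continuousAt.eventually_lt_const (Nat.lt_of_ceil_lt hn)] with y hy
  exact cutoff_eq_one (by linarith)

theorem exists_norm_fderiv_cutoff_mul_le :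
    ∃ C : ℝ, ∀ (n : ℕ) (x : V), ‖fderiv ℝ (cutoff n) x‖ * (1 + ‖x‖) ≤ C := by
  let bump : ContDiffBump (0 : V) := ⟨1, 2, one_pos, one_lt_two⟩
  obtain ⟨C, hC⟩ := exists_one_add_norm_mul_norm_fderiv_le bump.contDiff bump.hasCompactSupport
  refine ⟨C, fun n x => ?_⟩
  set c : ℝ := ((n : ℝ) + 1)⁻¹
  have hc_nonneg : 0 ≤ c := by positivity
  have hc_le : c ≤ 1 := inv_le_one_of_one_le₀ (by linarith [n.cast_nonneg (α := ℝ)])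
  have h_fderiv : fderiv ℝ (cutoff n) x = c • fderiv ℝ bump (c • x) := fderiv_comp_smul c
  calc ‖fderiv ℝ (cutoff n) x‖ * (1 + ‖x‖) = (c + ‖c • x‖) * ‖fderiv ℝ bump (c • x)‖ := by
        rw [h_fderiv, norm_smul, norm_smul, Real.norm_of_nonneg hc_nonneg]
        ring
    _ ≤ (1 + ‖c • x‖) * ‖fderiv ℝ bump (c • x)‖ := by gcongr
    _ ≤ C := hC (c • x)

theorem exists_norm_fderiv_cutoff_mul_le_of_norm_fderiv_le {h : V → ℝ} {L : ℝ}
    (hh : Differentiable ℝ h) (hL : ∀ x, ‖fderiv ℝ h x‖ ≤ L) :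
    ∃ C : ℝ, ∀ (n : ℕ) (x : V), ‖fderiv ℝ (fun y => cutoff n y * h y) x‖ ≤ C := by
  obtain ⟨C, hC⟩ := exists_norm_fderiv_cutoff_mul_le (V := V)
  have hL_nonneg : 0 ≤ L := (norm_nonneg _).trans (hL 0)
  have h_growth : ∀ x, ‖h x‖ ≤ (‖h 0‖ + L) * (1 + ‖x‖) := fun x => by
    have h_sub : ‖h x - h 0‖ ≤ L * ‖x - 0‖ := convex_univ.norm_image_sub_le_of_norm_fderiv_le
      (fun y _ => hh y) (fun y _ => hL y) trivial trivial
    rw [sub_zero] at h_sub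
    nlinarith [norm_le_norm_add_norm_sub' (h x) (h 0), norm_nonneg (h 0), norm_nonneg x]
  refine ⟨L + (‖h 0‖ + L) * C, fun n x => ?_⟩
  rw [fderiv_fun_mul ((contDiff_cutoff n).differentiable (by simp) x) (hh x)]
  refine (norm_add_le _ _).trans ?_
  rw [norm_smul, norm_smul]
  refine add_le_add ?_ ?_
  · exact (mul_le_of_le_one_left (norm_nonneg _) (norm_cutoff_le_one n x)).trans (hL x)
  · calc ‖h x‖ * ‖fderiv ℝ (cutoff n) x‖
        ≤ (‖h 0‖ + L) * (1 + ‖x‖) * ‖fderiv ℝ (cutoff n) x‖ := by gcongr; exact h_growth x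
      _ = (‖h 0‖ + L) * (‖fderiv ℝ (cutoff n) x‖ * (1 + ‖x‖)) := by ring
      _ ≤ (‖h 0‖ + L) * C := by gcongr; exact hC n x

end Truncation

section KineticTest

theorem inner_velocity_lorentz (e b p : R3) :
    inner ℝ (velocity p) (lorentz e b p) = inner ℝ (velocity p) e := by
  rw [lorentz, inner_add_right, inner_self_cross, add_zero]

theorem hasFDerivAt_kin (p : R3) : HasFDerivAt kin (innerSL ℝ (velocity p)) p := by
  have h_sqrt := ((hasStrictFDerivAt_norm_sq p).hasFDerivAt.const_add 1).sqrt (by positivity)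
  refine h_sqrt.congr_fderiv (ContinuousLinearMap.ext fun w => ?_)
  simp [velocity, kin]
  ring

theorem fderiv_kin_comp_snd (z w : R3 × R3) :
    fderiv ℝ (fun z : R3 × R3 => kin z.2) z w = inner ℝ (velocity z.2) w.2 := by
  have h_comp : HasFDerivAt (fun z : R3 × R3 => kin z.2) _ z :=
    (hasFDerivAt_kin z.2).comp z hasFDerivAt_snd
  rw [h_comp.fderiv]
  simp

theorem norm_fderiv_kin_comp_snd_le_one (z : R3 × R3) :
    ‖fderiv ℝ (fun z : R3 × R3 => kin z.2) z‖ ≤ 1 := by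
  refine ContinuousLinearMap.opNorm_le_bound _ zero_le_one fun w => ?_
  rw [fderiv_kin_comp_snd]
  exact (norm_inner_le_norm _ _).trans
    (mul_le_mul (norm_velocity_le_one _) (norm_snd_le w) (norm_nonneg _) zero_le_one)

/-- A compactly supported truncation of the kinetic energy `√(1 + |p|²)`, to be used as a test
function in the Vlasov equation. -/
def kinTest (n : ℕ) (z : R3 × R3) : ℝ := cutoff n z * kin z.2

theorem contDiff_kinTest (n : ℕ) : ContDiff ℝ ∞ (kinTest n) :=
  (contDiff_cutoff n).mul (contDiff_kin.comp contDiff_snd)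

theorem hasCompactSupport_kinTest (n : ℕ) : HasCompactSupport (kinTest n) :=
  (hasCompactSupport_cutoff n).mul_right

theorem norm_kinTest_le (n : ℕ) (z : R3 × R3) : ‖kinTest n z‖ ≤ kin z.2 := by
  rw [kinTest, norm_mul, Real.norm_of_nonneg (kin_pos z.2).le]
  exact mul_le_of_le_one_left (kin_pos z.2).le (norm_cutoff_le_one n z)

theorem eventually_kinTest_eventuallyEq (z : R3 × R3) :
    ∀ᶠ n in atTop, kinTest n =ᶠ[𝓝 z] fun z => kin z.2 := by
  filter_upwards [eventually_cutoff_eventuallyEq_one z] with n hn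
  filter_upwards [hn] with y hy
  rw [kinTest, hy, Pi.one_apply, one_mul]

theorem exists_norm_fderiv_kinTest_le :
    ∃ C : ℝ, ∀ (n : ℕ) (z : R3 × R3), ‖fderiv ℝ (kinTest n) z‖ ≤ C :=
  exists_norm_fderiv_cutoff_mul_le_of_norm_fderiv_le
    ((contDiff_kin.comp contDiff_snd).differentiable (by simp)) norm_fderiv_kin_comp_snd_le_one

theorem exists_norm_mul_kinTest_add_mul_fderiv_le : ∃ C : ℝ, ∀ (n : ℕ) (a b y : ℝ)
    (z w : R3 × R3), ‖a * (y * kinTest n z) + b * (y * fderiv ℝ (kinTest n) z w)‖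
      ≤ ‖a • (kin z.2 * y)‖ + C * ‖(b * y) • w‖ := by
  obtain ⟨C, hC⟩ := exists_norm_fderiv_kinTest_le
  refine ⟨C, fun n a b y z w => (norm_add_le _ _).trans (add_le_add ?_ ?_)⟩
  · rw [norm_mul, norm_mul, norm_smul, norm_mul, mul_comm ‖y‖,
      Real.norm_of_nonneg (kin_pos z.2).le]
    gcongr
    exact norm_kinTest_le n z
  · rw [← mul_assoc, ← smul_eq_mul, ← map_smul]
    exact (fderiv ℝ (kinTest n) z).le_of_opNorm_le (hC n z) _

theorem tendsto_mul_kinTest_add_mul_fderiv_drift (E B : ℝ → R3 → R3) (a b y t : ℝ)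
    (z : R3 × R3) :
    Tendsto (fun n => a * (y * kinTest n z) + b * (y * fderiv ℝ (kinTest n) z (drift E B t z)))
      atTop (𝓝 (a * (kin z.2 * y) + b * y * inner ℝ (velocity z.2) (E t z.1))) := by
  refine tendsto_const_nhds.congr' ?_
  filter_upwards [eventually_kinTest_eventuallyEq z] with n hn
  simp only [hn.eq_of_nhds, hn.fderiv_eq, fderiv_kin_comp_snd, drift, inner_velocity_lorentz]
  ring

theorem tendsto_integral_mul_kinTest {g : R3 × R3 → ℝ}
    (hg : Integrable fun z => kin z.2 * g z) :
    Tendsto (fun n => ∫ z, g z * kinTest n z) atTop (𝓝 (∫ z, kin z.2 * g z)) := by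
  have h_eq : ∀ n z, g z * kinTest n z = cutoff n z * (kin z.2 * g z) := fun n z => by
    rw [kinTest]
    ring
  simp only [h_eq]
  refine tendsto_integral_of_dominated_convergence _ (fun n =>
    (contDiff_cutoff n).continuous.aestronglyMeasurable.mul hg.1) hg.norm
    (fun n => ae_of_all _ fun z => ?_) (ae_of_all _ fun z => ?_)
  · rw [norm_mul]
    exact mul_le_of_le_one_left (norm_nonneg _) (norm_cutoff_le_one n z)
  · refine tendsto_const_nhds.congr' ?_
    filter_upwards [eventually_cutoff_eventuallyEq_one z] with n hn
    rw [hn.eq_of_nhds, Pi.one_apply, one_mul]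

end KineticTest

section KineticEnergy

variable {T : ℝ} {f₀ : R3 × R3 → ℝ} {E₀ B₀ : R3 → R3} {f : ℝ → R3 × R3 → ℝ} {E B : ℝ → R3 → R3}
  {θ : ℝ → ℝ}

theorem integral_mul_inner_velocity {t : ℝ} {U : R3 → R3} (hf : Integrable (f t))
    (hfU : Integrable fun z => f t z * inner ℝ (velocity z.2) (U z.1)) :
    ∫ z, f t z * inner ℝ (velocity z.2) (U z.1) = ∫ x, inner ℝ (U x) (currentDensity f t x) := by
  have hfv : Integrable (fun z : R3 × R3 => f t z • velocity z.2) :=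
    hf.smul_bdd 1 (continuous_velocity.comp continuous_snd).aestronglyMeasurable
      (ae_of_all _ fun z => norm_velocity_le_one z.2)
  rw [Measure.volume_eq_prod] at hfv hfU ⊢
  rw [integral_prod _ hfU]
  refine integral_congr_ae ?_
  filter_upwards [hfv.prod_right_ae] with x hx
  rw [currentDensity, ← integral_inner hx]
  simp only [real_inner_smul_right, real_inner_comm]

namespace IsWeakSolution

theorem integrable_mul_smul_drift (hsol : IsWeakSolution T f₀ E₀ B₀ f E B)
    (hθ : IsTimeTest T θ) (hρ : MemLinftyLp (Ico 0 T) 2 (absDensity fun t z => θ t * f t z)) :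
    Integrable (fun q : ℝ × (R3 × R3) => (θ q.1 * f q.1 q.2) • drift E B q.1 q.2)
      ((volume.restrict (Ico 0 T)).prod volume) :=
  integrable_smul_drift (hsol.f_L1.smul_of_hasCompactSupport hθ.continuous hθ.compact) hρ
    hsol.E_L2 hsol.B_L2

theorem kinetic_energy_prod (hsol : IsWeakSolution T f₀ E₀ B₀ f E B)
    (hkin₀ : Integrable fun z => kin z.2 * f₀ z) (hθ : IsTimeTest T θ)
    (hρ : MemLinftyLp (Ico 0 T) 2 (absDensity fun t z => θ t * f t z)) :
    ∫ q : ℝ × (R3 × R3), (deriv θ q.1 * (kin q.2.2 * f q.1 q.2)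
        + θ q.1 * f q.1 q.2 * inner ℝ (velocity q.2.2) (E q.1 q.2.1))
        ∂((volume.restrict (Ico 0 T)).prod volume)
      = -(θ 0 * ∫ z, kin z.2 * f₀ z) := by
  obtain ⟨C, hC⟩ := exists_norm_mul_kinTest_add_mul_fderiv_le
  have h_kin := (hsol.f_kin.smul_of_hasCompactSupport hθ.continuous_deriv
    hθ.compact.deriv).integrable_prod
  have h_drift := hsol.integrable_mul_smul_drift hθ hρ
  let F (n : ℕ) (q : ℝ × (R3 × R3)) : ℝ := deriv θ q.1 * (f q.1 q.2 * kinTest n q.2)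
    + θ q.1 * (f q.1 q.2 * fderiv ℝ (kinTest n) q.2 (drift E B q.1 q.2))
  have hF_meas : ∀ n, AEStronglyMeasurable (F n) ((volume.restrict (Ico 0 T)).prod volume) :=
    fun n => (hθ.continuous_deriv.aestronglyMeasurable.comp_fst.mul (hsol.integrable_mul
      (contDiff_kinTest n).continuous (hasCompactSupport_kinTest n)).1).add
        (hθ.continuous.aestronglyMeasurable.comp_fst.mul (hsol.integrable_mul_fderiv_drift
          (contDiff_kinTest n) (hasCompactSupport_kinTest n)).1)
  have h_dom := h_kin.norm.add (h_drift.norm.const_mul C)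
  have hF_bound : ∀ n, ∀ᵐ q ∂(volume.restrict (Ico 0 T)).prod volume, ‖F n q‖
      ≤ ‖deriv θ q.1 • (kin q.2.2 * f q.1 q.2)‖ + C * ‖(θ q.1 * f q.1 q.2) • drift E B q.1 q.2‖ :=
    fun n => ae_of_all _ fun q => hC n _ _ _ _ _
  have hF_int : ∀ n, ∫ q, F n q ∂((volume.restrict (Ico 0 T)).prod volume)
      = -(θ 0 * ∫ z, f₀ z * kinTest n z) := fun n =>
    (integral_prod _ (h_dom.mono' (hF_meas n) (hF_bound n))).trans
      (hsol.integral_vlasov (contDiff_kinTest n) (hasCompactSupport_kinTest n) hθ)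
  refine tendsto_nhds_unique (tendsto_integral_of_dominated_convergence _ hF_meas h_dom
    hF_bound (ae_of_all _ fun q => tendsto_mul_kinTest_add_mul_fderiv_drift E B _ _ _ _ _)) ?_
  simp only [hF_int]
  exact ((tendsto_integral_mul_kinTest hkin₀).const_mul (θ 0)).neg

theorem integrable_mul_inner_velocity (hsol : IsWeakSolution T f₀ E₀ B₀ f E B)
    (hθ : IsTimeTest T θ) (hρ : MemLinftyLp (Ico 0 T) 2 (absDensity fun t z => θ t * f t z)) :
    Integrable (fun q : ℝ × (R3 × R3) =>
        θ q.1 * f q.1 q.2 * inner ℝ (velocity q.2.2) (E q.1 q.2.1))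
      ((volume.restrict (Ico 0 T)).prod volume) := by
  have h_field := (hρ.smul_comp_position
    (hsol.f_L1.smul_of_hasCompactSupport hθ.continuous hθ.compact).1 hsol.E_L2).integrable_prod
  refine h_field.norm.mono' ?_ (ae_of_all _ fun q => ?_)
  · simpa only [Function.uncurry, Function.comp_apply, real_inner_smul_right, smul_eq_mul] using
      (continuous_velocity.comp (continuous_snd.comp continuous_snd)).aestronglyMeasurable.inner
        (𝕜 := ℝ) h_field.1
  · rw [← real_inner_smul_right]
    exact (norm_inner_le_norm _ _).trans
      (mul_le_of_le_one_left (norm_nonneg _) (norm_velocity_le_one _))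

theorem kinetic_energy (hsol : IsWeakSolution T f₀ E₀ B₀ f E B)
    (hkin₀ : Integrable fun z => kin z.2 * f₀ z) (hθ : IsTimeTest T θ)
    (hρ : MemLinftyLp (Ico 0 T) 2 (absDensity fun t z => θ t * f t z)) :
    ∫ t in Ico 0 T, (deriv θ t * (∫ z, kin z.2 * f t z)
        + ∫ x, inner ℝ (E t x) (θ t • currentDensity f t x))
      = -(θ 0 * ∫ z, kin z.2 * f₀ z) := by
  have h_f := (hsol.f_L1.smul_of_hasCompactSupport hθ.continuous hθ.compact).integrable_prod
  have h_kin := (hsol.f_kin.smul_of_hasCompactSupport hθ.continuous_deriv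
    hθ.compact.deriv).integrable_prod
  have h_inner := hsol.integrable_mul_inner_velocity hθ hρ
  refine Eq.trans ?_ ((integral_prod _ (h_kin.add h_inner)).symm.trans
    (hsol.kinetic_energy_prod hkin₀ hθ hρ))
  refine integral_congr_ae ?_
  filter_upwards [h_f.prod_right_ae, h_kin.prod_right_ae, h_inner.prod_right_ae]
    with t h_ft h_kin_t h_inner_t
  simp only [← currentDensity_mul]
  rw [← integral_mul_inner_velocity h_ft h_inner_t, ← integral_const_mul]
  exact (integral_add h_kin_t h_inner_t).symm

end IsWeakSolution

end KineticEnergy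

theorem integral_norm_sub_sq {X F : Type*} [MeasurableSpace X] {μ : Measure X}
    [NormedAddCommGroup F] [InnerProductSpace ℝ F] {u w : X → F} (hu : MemLp u 2 μ)
    (hw : MemLp w 2 μ) :
    ∫ x, ‖u x - w x‖ ^ 2 ∂μ
      = (∫ x, ‖u x‖ ^ 2 ∂μ) - 2 * (∫ x, inner ℝ (u x) (w x) ∂μ) + ∫ x, ‖w x‖ ^ 2 ∂μ := by
  have h_neg := integral_inner_eq_integral_norm_sq hu hw.neg
  simp only [Pi.neg_apply, inner_neg_right, integral_neg, norm_neg, ← sub_eq_add_neg] at h_neg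
  linarith

theorem exists_contDiff_integral_norm_sub_sq_le {V F : Type*} [NormedAddCommGroup V]
    [NormedSpace ℝ V] [FiniteDimensional ℝ V] [MeasurableSpace V] [BorelSpace V] {μ : Measure V}
    [IsFiniteMeasureOnCompacts μ] [NormedAddCommGroup F] [NormedSpace ℝ F] {u : V → F}
    (hu : MemLp u 2 μ) {ε : ℝ} (hε : 0 < ε) :
    ∃ ψ : V → F, ContDiff ℝ ∞ ψ ∧ HasCompactSupport ψ ∧ ∫ x, ‖u x - ψ x‖ ^ 2 ∂μ ≤ ε := by
  obtain ⟨ψ, hc, hψ, h_le⟩ := hu.exist_eLpNorm_sub_le (by simp) one_le_two (Real.sqrt_pos.2 hε)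
  refine ⟨ψ, hψ, hc, ?_⟩
  have h_meas := hu.1.sub (hψ.continuous.memLp_of_hasCompactSupport (p := 2) hc).1
  calc ∫ x, ‖u x - ψ x‖ ^ 2 ∂μ
      = (eLpNorm (u - ψ) 2 μ).toReal ^ 2 := by
        rw [← ENNReal.toReal_pow, ← integral_norm_sq_eq_toReal h_meas]; rfl
    _ ≤ √ε ^ 2 := by
        gcongr
        exact ENNReal.toReal_le_of_le_ofReal (Real.sqrt_nonneg ε) h_le
    _ = ε := Real.sq_sqrt hε.le

section TotalEnergy

variable {T : ℝ} {f₀ : R3 × R3 → ℝ} {E₀ B₀ : R3 → R3} {f : ℝ → R3 × R3 → ℝ} {E B : ℝ → R3 → R3}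
  {θ : ℝ → ℝ}

namespace IsWeakSolution

theorem integrableOn_kinetic (hsol : IsWeakSolution T f₀ E₀ B₀ f E B) :
    IntegrableOn (fun t => ∫ z, kin z.2 * f t z) (Ico 0 T) :=
  hsol.f_kin.integrable_prod.integral_prod_left

theorem integrableOn_field (hsol : IsWeakSolution T f₀ E₀ B₀ f E B) :
    IntegrableOn (fun t => ∫ x, (‖E t x‖ ^ 2 + ‖B t x‖ ^ 2)) (Ico 0 T) := by
  have h_sq := hsol.emField_L2.inner_of_holderTriple (r := 1) hsol.emField_L2
  simpa only [IntegrableOn, Function.uncurry_apply_pair, real_inner_self_eq_norm_sq,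
    norm_emField_sq] using
    h_sq.integrable_prod.integral_prod_left

theorem integrableOn_totalEnergy (hsol : IsWeakSolution T f₀ E₀ B₀ f E B) :
    IntegrableOn (fun t => totalEnergy (f t) (E t) (B t)) (Ico 0 T) :=
  hsol.integrableOn_kinetic.add (hsol.integrableOn_field.const_mul _)

theorem currentDensity_smul_L2 (hsol : IsWeakSolution T f₀ E₀ B₀ f E B)
    (hθ : IsTimeTest T θ) (hρ : MemLinftyLp (Ico 0 T) 2 (absDensity fun t z => θ t * f t z)) :
    MemLinftyLp (Ico 0 T) 2 fun t x => θ t • currentDensity f t x := by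
  simp only [← currentDensity_mul]
  exact .currentDensity_of_absDensity
    (hsol.f_L1.smul_of_hasCompactSupport hθ.continuous hθ.compact).1 hρ

theorem integral_deriv_mul_totalEnergy (hT : 0 < T)
    (hkin₀ : Integrable fun z => kin z.2 * f₀ z) (hE₀ : MemLp E₀ 2) (hB₀ : MemLp B₀ 2)
    (hsol : IsWeakSolution T f₀ E₀ B₀ f E B) (hθ : IsTimeTest T θ)
    (hρ : MemLinftyLp (Ico 0 T) 2 (absDensity fun t z => θ t * f t z)) :
    ∫ t in Ico 0 T, deriv θ t * totalEnergy (f t) (E t) (B t)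
      = -(θ 0 * totalEnergy f₀ E₀ B₀) := by
  have hθj := hsol.currentDensity_smul_L2 hθ hρ
  have h_power : IntegrableOn (fun t => ∫ x, inner ℝ (E t x) (θ t • currentDensity f t x))
      (Ico 0 T) :=
    (hsol.E_L2.inner_of_holderTriple (r := 1) hθj).integrable_prod.integral_prod_left
  have h_kin := (hθ.integrableOn_deriv_mul hsol.integrableOn_kinetic).add h_power
  have h_field := (hθ.integrableOn_deriv_mul hsol.integrableOn_field).sub
    (h_power.const_mul (8 * Real.pi))
  calc ∫ t in Ico 0 T, deriv θ t * totalEnergy (f t) (E t) (B t)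
      = ∫ t in Ico 0 T, ((deriv θ t * (∫ z, kin z.2 * f t z)
            + ∫ x, inner ℝ (E t x) (θ t • currentDensity f t x))
          + 1 / (8 * Real.pi) * (deriv θ t * (∫ x, (‖E t x‖ ^ 2 + ‖B t x‖ ^ 2))
            - 8 * Real.pi * ∫ x, inner ℝ (E t x) (θ t • currentDensity f t x))) := by
        congr with t
        rw [totalEnergy]
        field_simp
        ring
    _ = -(θ 0 * ∫ z, kin z.2 * f₀ z)
          + 1 / (8 * Real.pi) * -(θ 0 * ∫ x, (‖E₀ x‖ ^ 2 + ‖B₀ x‖ ^ 2)) := by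
        rw [← hsol.kinetic_energy hkin₀ hθ hρ, ← hsol.field_energy hT hE₀ hB₀ hθ hθj,
          ← integral_const_mul]
        exact integral_add h_kin (h_field.const_mul _)
    _ = -(θ 0 * totalEnergy f₀ E₀ B₀) := by rw [totalEnergy]; ring

theorem absDensity_mul_L2 {l : ℝ} {S : Set ℝ} (hl : 0 ≤ l)
    (hsol : IsWeakSolution T f₀ E₀ B₀ f E B) (hθ : IsTimeTest T θ) (hS : MeasurableSet S)
    (hST : S ⊆ Ico 0 T) (hθS : ∀ t ∈ Ico 0 T, t ∉ S → θ t = 0)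
    (hm : MemLinftyLp S 2 (moment l f)) :
    MemLinftyLp (Ico 0 T) 2 (absDensity fun t z => θ t * f t z) :=
  .absDensity_mul_of_support hθ.continuous hθ.compact measurableSet_Ico hS hθS hsol.f_L1.1
    (.absDensity_of_moment hl (hsol.f_L1.mono hST) (hsol.f_Linfty.mono hST)
      (ae_restrict_of_ae_restrict_of_subset hST hsol.f_nonneg) hm)

theorem absDensity_mul_L2_of_tsupport_subset_Ioo {l : ℝ} (hl : 0 ≤ l)
    (hsol : IsWeakSolution T f₀ E₀ B₀ f E B) (hθ : IsTimeTest T θ) (hs : tsupport θ ⊆ Ioo 0 T)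
    (hm : MemLinftylocLp T 2 (moment l f)) :
    MemLinftyLp (Ico 0 T) 2 (absDensity fun t z => θ t * f t z) := by
  obtain ⟨a, ha, hsa⟩ := exists_gt_subset_Ici hθ.compact.isCompact (hs.trans Ioo_subset_Ioi_self)
  obtain ⟨b, hb, hsb⟩ := exists_lt_subset_Iic hθ.compact.isCompact hθ.supp
  exact hsol.absDensity_mul_L2 hl hθ measurableSet_Icc
    (fun t ht => ⟨ha.le.trans ht.1, ht.2.trans_lt hb⟩)
    (fun t _ htS => image_eq_zero_of_notMem_tsupport fun h => htS ⟨hsa h, hsb h⟩) (hm a b ha hb)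

theorem absDensity_mul_L2_of_fromZero {l : ℝ} (hl : 0 ≤ l)
    (hsol : IsWeakSolution T f₀ E₀ B₀ f E B) (hθ : IsTimeTest T θ)
    (hm : MemLinftylocLpFromZero T 2 (moment l f)) :
    MemLinftyLp (Ico 0 T) 2 (absDensity fun t z => θ t * f t z) := by
  obtain ⟨b, hb, hsb⟩ := exists_lt_subset_Iic hθ.compact.isCompact hθ.supp
  exact hsol.absDensity_mul_L2 hl hθ measurableSet_Icc (Icc_subset_Ico_right hb)
    (fun t ht htS => image_eq_zero_of_notMem_tsupport fun h => htS ⟨ht.1, hsb h⟩) (hm b hb)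

end IsWeakSolution

end TotalEnergy

theorem integrableOn_integral_inner_weakSystem {V F ι : Type*} [Fintype ι] [NormedAddCommGroup V]
    [InnerProductSpace ℝ V] [FiniteDimensional ℝ V] [MeasurableSpace V] [BorelSpace V]
    [NormedAddCommGroup F] [InnerProductSpace ℝ F] {I : Set ℝ} [IsFiniteMeasure (volume.restrict I)]
    (e : ι → V) (A : ι → F →L[ℝ] F) {u J : ℝ → V → F} (hu : MemLinftyLp I 2 u)
    (hJ : MemLinftyLp I 1 J) {ψ : V → F} (hψ : ContDiff ℝ ∞ ψ) (hc : HasCompactSupport ψ) :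
    IntegrableOn (fun t => ∫ x, (inner ℝ (u t x) (∑ k, A k (fderiv ℝ ψ x (e k)))
      + inner ℝ (J t x) (ψ x))) I := by
  have h_cont : Continuous fun x => ∑ k, A k (fderiv ℝ ψ x (e k)) :=
    continuous_finsetSum _ fun k _ =>
      (A k).continuous.comp ((hψ.continuous_fderiv (by simp)).clm_apply continuous_const)
  have h_supp : HasCompactSupport fun x => ∑ k, A k (fderiv ℝ ψ x (e k)) :=
    (hc.fderiv ℝ).comp_left (g := fun L : V →L[ℝ] F => ∑ k, A k (L (e k))) (by simp)
  exact ((hu.inner_const_of_hasCompactSupport 2 h_cont h_supp).integrable_prod.add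
    (hJ.inner_const_of_hasCompactSupport ⊤ hψ.continuous hc).integrable_prod).integral_prod_left

section InitialEnergy

variable {T c : ℝ} {f₀ : R3 × R3 → ℝ} {E₀ B₀ : R3 → R3} {f : ℝ → R3 × R3 → ℝ}
  {E B : ℝ → R3 → R3} {ψ : R3 → FieldPair}

theorem totalEnergy_eq_emField (g : R3 × R3 → ℝ) (e b : R3 → R3) :
    totalEnergy g e b
      = (∫ z, kin z.2 * g z) + 1 / (8 * Real.pi) * ∫ x, ‖emField e b x‖ ^ 2 := by
  simp only [totalEnergy, norm_emField_sq]

namespace IsWeakSolution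

theorem ae_integral_mul_kinTest_le (hsol : IsWeakSolution T f₀ E₀ B₀ f E B) (n : ℕ) :
    ∀ᵐ t ∂(volume.restrict (Ico 0 T)), ∫ z, f t z * kinTest n z ≤ ∫ z, kin z.2 * f t z := by
  filter_upwards [hsol.f_nonneg, hsol.f_kin.integrable_prod.prod_right_ae,
    (hsol.integrable_mul (contDiff_kinTest n).continuous
      (hasCompactSupport_kinTest n)).prod_right_ae] with t h_nonneg h_kin h_test
  refine integral_mono_ae h_test h_kin ?_
  filter_upwards [h_nonneg] with z hz
  exact (mul_comm _ _).trans_le (mul_le_mul_of_nonneg_right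
    ((le_abs_self _).trans (norm_kinTest_le n z)) hz)

theorem initial_test_energy_le (hT : 0 < T) (hE₀ : MemLp E₀ 2) (hB₀ : MemLp B₀ 2)
    (hsol : IsWeakSolution T f₀ E₀ B₀ f E B)
    (hc : ∀ᵐ t ∂(volume.restrict (Ico 0 T)), totalEnergy (f t) (E t) (B t) ≤ c) (n : ℕ)
    (hψ : ContDiff ℝ ∞ ψ) (hψc : HasCompactSupport ψ) :
    (∫ z, f₀ z * kinTest n z) + 1 / (4 * Real.pi) * ∫ x, inner ℝ (emField E₀ B₀ x) (ψ x)
      ≤ c + 1 / (8 * Real.pi) * ∫ x, ‖ψ x‖ ^ 2 := by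
  have h_kin := contDiff_kinTest n
  have h_kin_c := hasCompactSupport_kinTest n
  have h_f := (hsol.integrable_mul h_kin.continuous h_kin_c).integral_prod_left
  have h_df := (hsol.integrable_mul_fderiv_drift h_kin h_kin_c).integral_prod_left
  have h_u := (hsol.emField_L2.inner_const_of_hasCompactSupport 2 hψ.continuous
    hψc).integrable_prod.integral_prod_left
  have h_du := integrableOn_integral_inner_weakSystem (fun k => EuclideanSpace.single k 1)
    maxwellMatrix hsol.emField_L2 (memLinftyLp_maxwellSource le_rfl hsol.f_L1.currentDensity)
    hψ hψc
  refine ((hsol.vlasov_weakODE h_kin h_kin_c).add h_f h_df (h_u.const_mul _) (h_du.const_mul _)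
    ((hsol.weakSystem_maxwell hE₀ hB₀ ψ hψ hψc).const_mul (1 / (4 * Real.pi)))).initial_le hT
    (h_f.add (h_u.const_mul _)) (h_df.add (h_du.const_mul _)) ?_
  filter_upwards [hc, hsol.ae_integral_mul_kinTest_le n, hsol.emField_L2.ae_memLp]
    with t h_energy h_kin_le h_mem
  have h_sub := integral_norm_sub_sq h_mem (hψ.continuous.memLp_of_hasCompactSupport hψc)
  have h_nonneg : 0 ≤ ∫ x, ‖emField (E t) (B t) x - ψ x‖ ^ 2 := by positivity
  rw [totalEnergy_eq_emField] at h_energy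
  have h_field : 1 / (4 * Real.pi) * ∫ x, inner ℝ (emField (E t) (B t) x) (ψ x)
      ≤ 1 / (8 * Real.pi) * ((∫ x, ‖emField (E t) (B t) x‖ ^ 2) + ∫ x, ‖ψ x‖ ^ 2) := by
    rw [show 1 / (4 * Real.pi) = 1 / (8 * Real.pi) * 2 by ring, mul_assoc]
    gcongr
    linarith
  simp only [Pi.add_apply, Function.uncurry_apply_pair]
  linarith

theorem initial_energy_le (hT : 0 < T) (hkin₀ : Integrable fun z => kin z.2 * f₀ z)
    (hE₀ : MemLp E₀ 2) (hB₀ : MemLp B₀ 2) (hsol : IsWeakSolution T f₀ E₀ B₀ f E B)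
    (hc : ∀ᵐ t ∂(volume.restrict (Ico 0 T)), totalEnergy (f t) (E t) (B t) ≤ c) :
    totalEnergy f₀ E₀ B₀ ≤ c := by
  refine le_of_forall_pos_le_add fun ε hε => ?_
  have hu₀ := memLp_emField hE₀ hB₀
  obtain ⟨ψ, hψ, hψc, h_close⟩ :=
    exists_contDiff_integral_norm_sub_sq_le hu₀ (show 0 < 8 * Real.pi * ε by positivity)
  have h_lim := le_of_tendsto ((tendsto_integral_mul_kinTest hkin₀).add_const _)
    (Eventually.of_forall fun n => hsol.initial_test_energy_le hT hE₀ hB₀ hc n hψ hψc)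
  rw [integral_norm_sub_sq hu₀ (hψ.continuous.memLp_of_hasCompactSupport hψc)] at h_close
  have h_field : 1 / (8 * Real.pi) * (∫ x, ‖emField E₀ B₀ x‖ ^ 2)
      ≤ 1 / (4 * Real.pi) * (∫ x, inner ℝ (emField E₀ B₀ x) (ψ x))
        - 1 / (8 * Real.pi) * (∫ x, ‖ψ x‖ ^ 2) + ε := by
    field_simp
    linarith
  rw [totalEnergy_eq_emField]
  linarith

end IsWeakSolution

end InitialEnergy

section Conservation

variable {T l : ℝ} {f₀ : R3 × R3 → ℝ} {E₀ B₀ : R3 → R3} {f : ℝ → R3 × R3 → ℝ} {E B : ℝ → R3 → R3}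

namespace IsWeakSolution

theorem exists_totalEnergy_ae_eq_const (hT : 0 < T) (hl : 0 ≤ l)
    (hkin₀ : Integrable fun z => kin z.2 * f₀ z) (hE₀ : MemLp E₀ 2) (hB₀ : MemLp B₀ 2)
    (hsol : IsWeakSolution T f₀ E₀ B₀ f E B) (hm : MemLinftylocLp T 2 (moment l f)) :
    ∃ c, ∀ᵐ t ∂(volume.restrict (Ico 0 T)), totalEnergy (f t) (E t) (B t) = c := by
  refine exists_ae_eq_const_of_forall_isTimeTest hT hsol.integrableOn_totalEnergy
    fun θ hθ hs => ?_
  have hθ₀ : θ 0 = 0 := image_eq_zero_of_notMem_tsupport fun h => lt_irrefl (0 : ℝ) (hs h).1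
  rw [hsol.integral_deriv_mul_totalEnergy hT hkin₀ hE₀ hB₀ hθ
    (hsol.absDensity_mul_L2_of_tsupport_subset_Ioo hl hθ hs hm), hθ₀, zero_mul, neg_zero]

theorem totalEnergy_ae_eq_initial (hT : 0 < T) (hl : 0 ≤ l)
    (hkin₀ : Integrable fun z => kin z.2 * f₀ z) (hE₀ : MemLp E₀ 2) (hB₀ : MemLp B₀ 2)
    (hsol : IsWeakSolution T f₀ E₀ B₀ f E B) (hm : MemLinftylocLpFromZero T 2 (moment l f)) :
    ∀ᵐ t ∂(volume.restrict (Ico 0 T)),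
      totalEnergy (f t) (E t) (B t) = totalEnergy f₀ E₀ B₀ := by
  refine WeakODE.ae_eq_const hT hsol.integrableOn_totalEnergy fun θ hθ => ?_
  simpa only [mul_zero, add_zero] using hsol.integral_deriv_mul_totalEnergy hT hkin₀ hE₀ hB₀ hθ
    (hsol.absDensity_mul_L2_of_fromZero hl hθ hm)

end IsWeakSolution

end Conservation

end RVM

end

theorem theorem1_general (T : ℝ) (hT : 0 < T) (l : ℝ) (hl : 0 ≤ l)
    (f₀ : RVM.R3 × RVM.R3 → ℝ) (E₀ B₀ : RVM.R3 → RVM.R3)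
    (hkin₀ : Integrable fun z => RVM.kin z.2 * f₀ z) (hE₀ : MemLp E₀ 2) (hB₀ : MemLp B₀ 2)
    (f : ℝ → RVM.R3 × RVM.R3 → ℝ) (E B : ℝ → RVM.R3 → RVM.R3)
    (hsol : RVM.IsWeakSolution T f₀ E₀ B₀ f E B)
    (hmoment : RVM.MemLinftylocLp T 2 (RVM.moment l f)) :
    (∃ c : ℝ, RVM.totalEnergy f₀ E₀ B₀ ≤ c ∧
      ∀ᵐ t ∂(volume.restrict (Ico 0 T)), RVM.totalEnergy (f t) (E t) (B t) = c) ∧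
    ((RVM.MemLinftylocLpFromZero T 2 (RVM.moment l f) ∨
        ∀ᵐ t ∂(volume.restrict (Ico 0 T)),
          RVM.totalEnergy (f t) (E t) (B t) ≤ RVM.totalEnergy f₀ E₀ B₀) →
      ∀ᵐ t ∂(volume.restrict (Ico 0 T)),
        RVM.totalEnergy (f t) (E t) (B t) = RVM.totalEnergy f₀ E₀ B₀) := by
  obtain ⟨c, h_const⟩ := hsol.exists_totalEnergy_ae_eq_const hT hl hkin₀ hE₀ hB₀ hmoment
  have h_le := hsol.initial_energy_le hT hkin₀ hE₀ hB₀ (h_const.mono fun t ht => ht.le)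
  refine ⟨⟨c, h_le, h_const⟩, ?_⟩
  rintro (h_moment₀ | h_energy)
  · exact hsol.totalEnergy_ae_eq_initial hT hl hkin₀ hE₀ hB₀ h_moment₀
  · filter_upwards [h_const, h_energy] with t ht h_le_initial
    exact le_antisymm h_le_initial (h_le.trans ht.ge)

theorem theorem1 (T : ℝ) (hT : 0 < T) (l : ℝ) (hl : 0 < l)
    (f₀ : RVM.R3 × RVM.R3 → ℝ) (E₀ B₀ : RVM.R3 → RVM.R3)
    (hf₀ : RVM.MemL1kinLinfty f₀) (hE₀ : MemLp E₀ 2) (hB₀ : MemLp B₀ 2)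
    (f : ℝ → RVM.R3 × RVM.R3 → ℝ) (E B : ℝ → RVM.R3 → RVM.R3)
    (hsol : RVM.IsWeakSolution T f₀ E₀ B₀ f E B)
    (hE : ∀ i : Fin 3, RVM.MemL1locBVloc T fun t x => E t x i)
    (hB : ∀ i : Fin 3, RVM.MemL1locBVloc T fun t x => B t x i)
    (hmoment : RVM.MemLinftylocLp T 2 (RVM.moment l f)) :
    (∃ c : ℝ, RVM.totalEnergy f₀ E₀ B₀ ≤ c ∧
      ∀ᵐ t ∂(volume.restrict (Ico 0 T)), RVM.totalEnergy (f t) (E t) (B t) = c) ∧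
    ((RVM.MemLinftylocLpFromZero T 2 (RVM.moment l f) ∨
        ∀ᵐ t ∂(volume.restrict (Ico 0 T)),
          RVM.totalEnergy (f t) (E t) (B t) ≤ RVM.totalEnergy f₀ E₀ B₀) →
      ∀ᵐ t ∂(volume.restrict (Ico 0 T)),
        RVM.totalEnergy (f t) (E t) (B t) = RVM.totalEnergy f₀ E₀ B₀) :=
  theorem1_general T hT l hl.le f₀ E₀ B₀ hf₀.integrable_kin hE₀ hB₀ f E B hsol hmoment
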